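/- **Setting.** Let $q$ be a prime power, $m\ge 0$, $s\ge 1$, $d\ge 0$ integers. For a multi-index $\mathbf i\in\mathbb Z_{\ge0}^m$ put $\mathrm{wt}(\mathbf i)=\sum_k i_k$, and let $P^{(\mathbf i)}$ be the $\mathbf i$-th Hasse derivative of $P\in\mathbb F_q[X_1,\dots,X_m]$, i.e. the coefficient of $\mathbf Z^{\mathbf i}$ in $P(\mathbf X+\mathbf Z)$. Let $\Sigma=\mathbb F_q^{\{\mathbf i:\mathrm{wt}(\mathbf i)<s\}}$, $P^{(<s)}(\mathbf a)=(P^{(\mathbf i)}(\mathbf a))_{\mathrm{wt}(\mathbf i)<s}\in\Sigma$ and $\mathrm{Enc}_{s,d,m,q}(P)=(P^{(<s)}(\mathbf a))_{\mathbf a\in\mathbb F_q^m}$ for $\deg P\le d$. Let $\Delta$ be the normalized Hamming distance, $\delta=1-\frac{d}{sq}$, $\delta_0<\delta/8$, $\gamma=\frac{\delta-8\delta_0}{1-8\delta_0}$, $c=\lfloor\gamma s\rfloor+1$, and let $S\subseteq\mathbb F_q$ be any set with $|S|=\lceil 5s/c\rceil$. **Algorithm.** Input: oracle access to $r:\mathbb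 F_q^m\to\Sigma$ (with coordinates $r^{(\mathbf i)}$), and a point $\mathbf a\in\mathbb F_q^m$. 1. Pick $\mathbf z,\mathbf y_1,\dots,\mathbf y_m\in\mathbb F_q^m$ independently and uniformly at random, and let $B=\{\mathbf z+\sum_j\alpha_j\mathbf y_j:\alpha\in S^m\}$. Query $r$ at all points $\mathbf a+t\mathbf b$ with $\mathbf b\in B$, $t\in\mathbb F_q$. 2. For each $\mathbf b\in B$ and each $\mathbf l$ with $\mathrm{wt}(\mathbf l)<c$ define $\ell_{\mathbf b,\mathbf l}:\mathbb F_q\to\mathbb F_q^{\,s-\mathrm{wt}(\mathbf l)}$ by $$(\ell_{\mathbf b,\mathbf l}(t))_j=\sum_{\mathrm{wt}(\mathbf i)=j}\binom{\mathbf l+\mathbf i}{\mathbf l}\,r^{(\mathbf l+\mathbf i)}(\mathbf a+t\mathbf b)\,\mathbf b^{\mathbf i}\qquad(0\le j<s-\mathrm{wt}(\mathbf l)),$$ and let $Q_{\mathbf b,\mathbf l}(T)$ be the unique polynomial of degree at most $d-\mathrm{wt}(\mathbf l)$, if any, with $\Delta(\mathrm{Enc}_{s-\mathrm{wt}(\mathbf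 l),\,d-\mathrm{wt}(\mathbf l),\,1,\,q}(Q_{\mathbf b,\mathbf l}),\ell_{\mathbf b,\mathbf l})<4\delta_0$ (univariate multiplicity decoding). Let $v_{j,\mathbf b,\mathbf l}$ be the coefficient of $T^j$ in $Q_{\mathbf b,\mathbf l}$, and $v_{j,\mathbf b,\mathbf l}=0$ for $j<0$. 3. For each $0\le j'<s$ find the unique homogeneous polynomial $R_{j'}$ of degree $j'$ such that for at least $2/3$ of the $\mathbf b\in B$ one has $R_{j'}^{(\mathbf l)}(\mathbf b)=v_{j'-\mathrm{wt}(\mathbf l),\mathbf b,\mathbf l}$ for all $\mathbf l$ with $\mathrm{wt}(\mathbf l)<c$ (multivariate multiplicity decoding; the equation counts as violated when its right-hand side is undefined). If for some $j'$ there is no such $R_{j'}$ or more than one, output FAIL. Otherwise output $(u_{\mathbf i})_{\mathrm{wt}(\mathbf i)<s}$, where $u_{\mathbf i}$ is the coefficient of $\mathbf X^{\mathbf i}$ in $R_{\mathrm{wt}(\mathbf i)}$. **Theorem.** Let $P\in\mathbb F_q[X_1,\dots,X_m]$ with $\deg P\le d$ and $r:\mathbb F_q^m\to\Sigma$ satisfy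 $\Delta(\mathrm{Enc}_{s,d,m,q}(P),r)<\delta_0$. Then for every $\mathbf a\in\mathbb F_q^m$ the algorithm outputs $P^{(<s)}(\mathbf a)$ with high probability, namely with probability at least $$1-\frac{27}{|S|^m+27}-\frac{4}{\delta_0\,q}.$$ For every choice of $\mathbf z,\mathbf y_1,\dots,\mathbf y_m$ its queries are exactly the points of the lines $\{\mathbf a+t\mathbf b:t\in\mathbb F_q\}$, $\mathbf b\in B$; there are at most $|S|^m$ directions $\mathbf b\in B$ and at most $|S|^m q$ queries, where $|S|\le\lceil 5/\gamma\rceil$. -/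

import Mathlib

namespace MultCode

noncomputable section

open scoped Classical

/-! ### Codes -/

/-- The normalized Hamming distance `Δ(x, y)`: the fraction of coordinates in which `x`, `y` differ. -/
def relDist {ι A : Type*} [Fintype ι] (x y : ι → A) : ℝ :=
  (hammingDist x y : ℝ) / (Fintype.card ι : ℝ)

/-- The probability of an event under the uniform distribution on a finite set. -/
def uniformProb {Ω : Type*} [Fintype Ω] (p : Ω → Prop) : ℝ :=
  ((Finset.univ.filter p).card : ℝ) / (Fintype.card Ω : ℝ)

/-! ### Hasse derivatives and multiplicity codes

Multi-indices are elements `i : Fin m →₀ ℕ`, with weight `i.degree = ∑ k, i k`. -/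

/-- The `i`-th Hasse derivative of `P`: the coefficient of `Z ^ i` in `P(X + Z)`, where `P(X + Z)`
is regarded as a polynomial in `Z` whose coefficients are polynomials in `X`. -/
def hasse {σ R : Type*} [CommSemiring R] (i : σ →₀ ℕ) (P : MvPolynomial σ R) : MvPolynomial σ R :=
  MvPolynomial.coeff i
    (MvPolynomial.aeval
      (fun k : σ => (MvPolynomial.C (MvPolynomial.X k) + MvPolynomial.X k :
        MvPolynomial σ (MvPolynomial σ R))) P)

/-- The alphabet `Σ` of the order-`s` code in `m` variables: one field element for each multi-index
of weight less than `s`. -/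
abbrev Alphabet (F : Type*) (m s : ℕ) : Type _ :=
  {i : Fin m →₀ ℕ // i.degree < s} → F

variable {F : Type*} [Field F] {m : ℕ}

/-- The order-`s` evaluation `P^{(<s)}(a)`. -/
def orderEval (s : ℕ) (P : MvPolynomial (Fin m) F) (a : Fin m → F) : Alphabet F m s :=
  fun i => MvPolynomial.eval a (hasse i.1 P)

/-- The codeword of `P` in the `m`-variate multiplicity code of order `s`. -/
def enc (s : ℕ) (P : MvPolynomial (Fin m) F) : (Fin m → F) → Alphabet F m s :=
  fun a => orderEval s P a

/-- The codeword of `Q` in the univariate multiplicity code of order `n`. -/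
def uniEnc (n : ℕ) (Q : Polynomial F) : F → (Fin n → F) :=
  fun t j => (Polynomial.hasseDeriv (j : ℕ) Q).eval t

/-! ### Parameters of the algorithm -/

/-- The (designed) distance `δ = 1 - d / (s q)`. -/
def delta (s d q : ℕ) : ℝ := 1 - (d : ℝ) / ((s : ℝ) * (q : ℝ))

/-- `γ = (δ - 8 δ₀) / (1 - 8 δ₀)`. -/
def gam (s d q : ℕ) (δ₀ : ℝ) : ℝ := (delta s d q - 8 * δ₀) / (1 - 8 * δ₀)

/-- `c = γ s + 1`, with `γ s` rounded down to an integer. -/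
def ordC (s d q : ℕ) (δ₀ : ℝ) : ℕ := ⌊gam s d q δ₀ * (s : ℝ)⌋₊ + 1

/-- The size `⌈5 s / c⌉` of the set `S`. -/
def gridSize (s d q : ℕ) (δ₀ : ℝ) : ℕ := ⌈5 * (s : ℝ) / (ordC s d q δ₀ : ℝ)⌉₊

/-! ### Non-adaptive oracle algorithms -/

/-- A non-adaptive algorithm with oracle access to a word `r : I → A`: it fixes a finite set of
queries, and its output is a function of the answers to these queries alone. -/
structure QueryAlg (I A O : Type*) where
  /-- The positions at which the word is queried. -/
  queries : Finset I
  /-- The output, as a function of the answers. -/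
  output : ({x // x ∈ queries} → A) → O

/-- The output of the algorithm on the word `r`. -/
def QueryAlg.run {I A O : Type*} (M : QueryAlg I A O) (r : I → A) : O :=
  M.output (fun x => r x.1)

/-! ### The local correction algorithm -/

/-- The unique `x` such that `p x`; `none` if there is no such `x` or more than one. -/
def findUnique {α : Type*} (p : α → Prop) : Option α :=
  if h : ∃! x, p x then some h.choose else none

/-- The set of directions `B = {z + ∑ j, α j • y j | α ∈ S ^ m}`. -/
def directions (S : Finset F) (z : Fin m → F) (y : Fin m → Fin m → F) : Finset (Fin m → F) :=
  (Fintype.piFinset (fun _ : Fin m => S)).image (fun α => z + ∑ j, α j • y j)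

/-- The points of the lines `{a + t • b | t ∈ F}`, for all directions `b ∈ B`. -/
def linePoints [Fintype F] (a : Fin m → F) (B : Finset (Fin m → F)) : Finset (Fin m → F) :=
  (B ×ˢ (Finset.univ : Finset F)).image (fun p => a + p.2 • p.1)

/-- The coordinate with multi-index `i` of a symbol (only used for `i.degree < s`). -/
def symbolCoord {s : ℕ} (u : Alphabet F m s) (i : Fin m →₀ ℕ) : F :=
  if h : i.degree < s then u ⟨i, h⟩ else 0

/-- The binomial coefficient `(l + i choose l) = ∏ k, (l k + i k choose l k)`. -/
def multiChoose (l i : Fin m →₀ ℕ) : ℕ := ∏ k, (l k + i k).choose (l k)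

/-- The univariate received word `ℓ_{b,l}` on the line through `a` in direction `b`: its `j`-th
coordinate at `t` is the sum of `(l + i choose l) * r^{(l + i)}(a + t b) * b ^ i` over all `i` of
weight `j`, for `j < s - wt(l)`. -/
def lineWord {s : ℕ} (r : (Fin m → F) → Alphabet F m s) (a b : Fin m → F) (l : Fin m →₀ ℕ) :
    F → (Fin (s - l.degree) → F) :=
  fun t j => ∑ i ∈ Finset.finsuppAntidiag (Finset.univ : Finset (Fin m)) (j : ℕ),
    (multiChoose l i : F) * symbolCoord (r (a + t • b)) (l + i) * ∏ k, b k ^ i k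

/-- Univariate decoding: the unique polynomial `Q_{b,l}` of degree at most `d - wt(l)` (only `0` if
this is negative) whose codeword of order `s - wt(l)` is at distance less than `4 δ₀` from
`ℓ_{b,l}`, if there is one. -/
def decodeLine [Fintype F] {s : ℕ} (d : ℕ) (δ₀ : ℝ) (r : (Fin m → F) → Alphabet F m s)
    (a b : Fin m → F) (l : Fin m →₀ ℕ) : Option (Polynomial F) :=
  findUnique (fun Q => Q ∈ Polynomial.degreeLT F (d + 1 - l.degree) ∧
    relDist (uniEnc (s - l.degree) Q) (lineWord r a b l) < 4 * δ₀)

/-- The value `v_{j' - wt(l), b, l}`: the coefficient of `T ^ (j' - wt(l))` in `Q_{b,l}`, which is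
`0` if `j' < wt(l)`, and otherwise undefined (`none`) if `Q_{b,l}` does not exist. -/
def lineValue [Fintype F] {s : ℕ} (d : ℕ) (δ₀ : ℝ) (r : (Fin m → F) → Alphabet F m s)
    (a : Fin m → F) (j' : ℕ) (b : Fin m → F) (l : Fin m →₀ ℕ) : Option F :=
  if l.degree ≤ j' then (decodeLine d δ₀ r a b l).map (fun Q => Q.coeff (j' - l.degree))
  else some 0

/-- `R` is homogeneous of degree `j'`, and for at least `2/3` of the directions `b ∈ B` one has
`R^{(l)}(b) = v_{j' - wt(l), b, l}` for all `l` with `wt(l) < c`. -/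
def IsCombination [Fintype F] {s : ℕ} (d : ℕ) (δ₀ : ℝ) (r : (Fin m → F) → Alphabet F m s)
    (a : Fin m → F) (B : Finset (Fin m → F)) (j' : ℕ) (R : MvPolynomial (Fin m) F) : Prop :=
  R.IsHomogeneous j' ∧
    2 * B.card ≤ 3 * (B.filter (fun b => ∀ l : Fin m →₀ ℕ,
      l.degree < ordC s d (Fintype.card F) δ₀ →
        lineValue d δ₀ r a j' b l = some (MvPolynomial.eval b (hasse l R)))).card

/-- The combination step: for each `j' < s` find the unique `R_{j'}`, and output the coefficients of
`X ^ i` in `R_{wt(i)}`, for all `i` with `wt(i) < s`. The result is `none` (the algorithm fails) if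
some `R_{j'}` does not exist or is not unique. -/
def combine [Fintype F] {s : ℕ} (d : ℕ) (δ₀ : ℝ) (r : (Fin m → F) → Alphabet F m s)
    (a : Fin m → F) (B : Finset (Fin m → F)) : Option (Alphabet F m s) :=
  if h : ∀ j' : Fin s, ∃! R : MvPolynomial (Fin m) F, IsCombination d δ₀ r a B (j' : ℕ) R then
    some (fun i => MvPolynomial.coeff i.1 (h ⟨i.1.degree, i.2⟩).choose)
  else none

/-- The local correction algorithm at the point `a`, with grid `S ^ m` and random choices `z`, `y`.
It queries the received word on the lines through `a` with directions in `B`, decodes on these lines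
and combines the results. (The word is extended by `0` to the points that are not queried.) -/
def localCorrector [Fintype F] (s d : ℕ) (δ₀ : ℝ) (S : Finset F) (a : Fin m → F)
    (z : Fin m → F) (y : Fin m → Fin m → F) :
    QueryAlg (Fin m → F) (Alphabet F m s) (Option (Alphabet F m s)) where
  queries := linePoints a (directions S z y)
  output := fun ans =>
    combine d δ₀
      (fun x => if h : x ∈ linePoints a (directions S z y) then ans ⟨x, h⟩ else 0)
      a (directions S z y)

end

end MultCode

/-! Write G = P(a + X), with homogeneous parts G_j. The values P^{(i)}(a) are the coefficients of
the G_j with j < s, so it suffices that each R_{j'} equals G_{j'}. The bridge is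
`eval_hasse_homogeneousComponent_translate`: the coefficient of T^j in P^{(l)}(a + Tb) is
G_{wt(l)+j}^{(l)}(b). A direction b whose line is decoded correctly therefore yields the Hasse
derivatives of weight below c of every G_{j'} at b.

Decoding is correct on any line with fewer than 4δ₀q errors, because γ is chosen so that the
univariate codes with wt(l) ≤ γs keep relative distance at least 8δ₀
(`eq_of_hammingDist_uniEnc_lt`). If this covers 2/3 of B, then G_{j'} is a candidate for R_{j'}. Two
candidates agree to order c on a third of B, and |S|c ≥ 5s contradicts Schwartz–Zippel with
multiplicities (`card_mul_sum_multiplicity_le`), transported from S^m to the affine grid B. The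
transport needs y_1, ..., y_m to be linearly independent, which also gives |B| = |S|^m.

It remains to bound the probability of failure. A direction is uniform, so by Markov its line is bad
with probability p ≤ 1/4 + ε, where ε = 1/(4δ₀q). Directions with distinct parameters are pairwise
independent, so Cantelli bounds the probability that more than a third are bad; at p = 1/4 the bound
is 27/(|S|^m + 27). The excess ε in p, together with the probability at most 1/(q - 1) of dependent
y_j, costs at most 16ε = 4/(δ₀q). -/

namespace MultCode

open scoped Classical

open MvPolynomial

/-! ### Hasse derivatives as Taylor coefficients, and their restriction to lines. -/

section Hasse

variable {σ R : Type*} [CommSemiring R]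

/-- The polynomial `P(a + X)`. -/
noncomputable def translate (a : σ → R) : MvPolynomial σ R →ₐ[R] MvPolynomial σ R :=
  aeval (fun k => C (a k) + X k)

lemma eval_hasse (a : σ → R) (i : σ →₀ ℕ) (P : MvPolynomial σ R) :
    eval a (hasse i P) = coeff i (translate a P) := by
  rw [hasse, ← coeff_map]
  congr 1
  have h : ((mapAlgHom (aeval a : MvPolynomial σ R →ₐ[R] R)).comp
      (aeval (fun k : σ => (C (X k) + X k : MvPolynomial σ (MvPolynomial σ R))))) =
      translate a := by
    apply algHom_ext
    intro k
    simp [translate]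
  exact DFunLike.congr_fun h P

lemma hasse_add (i : σ →₀ ℕ) (P Q : MvPolynomial σ R) :
    hasse i (P + Q) = hasse i P + hasse i Q := by
  simp [hasse]

end Hasse

section Fin

variable {m : ℕ}

lemma coeff_hasse {R : Type*} [CommSemiring R] (l n : Fin m →₀ ℕ) (P : MvPolynomial (Fin m) R) :
    coeff n (hasse l P) = (multiChoose l n : R) * coeff (l + n) P := by
  induction P using MvPolynomial.induction_on' with
  | add p q hp hq => rw [hasse_add, coeff_add, coeff_add, hp, hq, mul_add]
  | monomial k r =>
    have key : aeval (fun k : Fin m =>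
        (C (X k) + X k : MvPolynomial (Fin m) (MvPolynomial (Fin m) R))) (monomial k r) =
        ∑ f ∈ Fintype.piFinset (fun j => Finset.range (k j + 1)),
          monomial (k - Finsupp.equivFunOnFinite.symm f)
            (monomial (Finsupp.equivFunOnFinite.symm f) (r * ∏ j, ((k j).choose (f j) : R))) := by
      rw [aeval_monomial, Finsupp.prod_fintype _ _ (by simp)]
      simp_rw [add_pow]
      rw [Finset.prod_univ_sum, Finset.mul_sum]
      refine Finset.sum_congr rfl fun f _ => ?_
      have h1 : ∀ (A : Type _) [CommSemiring A] (e : Fin m →₀ ℕ) (x : A),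
          monomial e x = C x * ∏ j, (X j : MvPolynomial (Fin m) A) ^ e j := by
        intro A _ e x
        rw [monomial_eq, Finsupp.prod_fintype _ _ (by simp)]
      rw [h1 _ (k - _), h1 _ (Finsupp.equivFunOnFinite.symm f)]
      simp only [Finset.prod_mul_distrib, map_mul, map_prod, map_pow, map_natCast,
        Finsupp.coe_equivFunOnFinite_symm, Finsupp.coe_tsub, Pi.sub_apply, algebraMap_eq,
        MvPolynomial.algebraMap_apply]
      ring
    rw [hasse, key]
    simp only [coeff_sum, coeff_monomial, apply_ite (coeff n), coeff_zero]
    by_cases hk : k = l + n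
    · subst hk
      rw [Finset.sum_eq_single (⇑n)]
      · simp only [Finsupp.equivFunOnFinite_symm_coe, add_tsub_cancel_right, if_true, multiChoose,
          Finsupp.add_apply, Nat.cast_prod, mul_comm r]
        exact congrArg (· * r) (Finset.prod_congr rfl fun j _ => by
          rw [Nat.choose_symm_add])
      · intro f _ hf
        have : Finsupp.equivFunOnFinite.symm f ≠ n := by
          rintro rfl
          exact hf rfl
        simp [this]
      · intro h
        exact absurd (Fintype.mem_piFinset.2 fun j => by simp) h
    · rw [if_neg hk, mul_zero]
      refine Finset.sum_eq_zero fun f hf => ?_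
      split_ifs with h1 h2
      · refine absurd ?_ hk
        subst h2
        rw [← h1, tsub_add_cancel_of_le]
        intro j
        have := Fintype.mem_piFinset.1 hf j
        simp at this ⊢
        omega
      · rfl
      · rfl

/-- Both sides are the product over k of the trinomial coefficients (l+i+n)! / (l! i! n!). -/
lemma multiChoose_trinomial (l i n : Fin m →₀ ℕ) :
    multiChoose i n * multiChoose l (i + n) = multiChoose l i * multiChoose (l + i) n := by
  simp only [multiChoose, ← Finset.prod_mul_distrib, Finsupp.add_apply]
  refine Finset.prod_congr rfl fun k _ => ?_
  have h := Nat.choose_mul (n := l k + (i k + n k)) (k := l k + i k) (s := l k)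
    (by omega)
  simp only [← add_assoc] at h ⊢
  rw [show l k + i k + n k - l k = i k + n k by omega, show l k + i k - l k = i k by omega] at h
  rw [mul_comm, ← h, mul_comm]

lemma hasse_hasse {R : Type*} [CommSemiring R] (l i : Fin m →₀ ℕ) (P : MvPolynomial (Fin m) R) :
    hasse i (hasse l P) = C (multiChoose l i : R) * hasse (l + i) P := by
  ext n
  rw [coeff_C_mul, coeff_hasse, coeff_hasse, coeff_hasse, ← mul_assoc, ← mul_assoc, add_assoc]
  congr 1
  exact_mod_cast congrArg (Nat.cast (R := R)) (multiChoose_trinomial l i n)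

variable {F : Type*} [Field F]

/-- The restriction `P(a + T b)` of `P` to a line. -/
noncomputable def restrictLine (a b : Fin m → F) : MvPolynomial (Fin m) F →ₐ[F] Polynomial F :=
  aeval (fun k => Polynomial.C (a k) + Polynomial.C (b k) * Polynomial.X)

lemma coeff_aeval_C_mul_X (b : Fin m → F) (G : MvPolynomial (Fin m) F) (j : ℕ) :
    (aeval (fun k => Polynomial.C (b k) * Polynomial.X) G : Polynomial F).coeff j =
      ∑ i ∈ Finset.finsuppAntidiag (Finset.univ : Finset (Fin m)) j,
        coeff i G * ∏ k, b k ^ i k := by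
  induction G using MvPolynomial.induction_on' with
  | add p q hp hq => simp only [map_add, Polynomial.coeff_add, hp, hq, coeff_add, add_mul,
      Finset.sum_add_distrib]
  | monomial e r =>
    rw [aeval_monomial, Finsupp.prod_fintype _ _ (by simp)]
    simp only [mul_pow, Finset.prod_mul_distrib, Finset.prod_pow_eq_pow_sum, coeff_monomial,
      ite_mul, zero_mul, Finset.sum_ite_eq, Finset.mem_finsuppAntidiag, Polynomial.algebraMap_eq]
    simp only [← Polynomial.C_pow, ← map_prod, ← mul_assoc, ← map_mul]
    rw [Polynomial.coeff_C_mul_X_pow]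
    simp [eq_comm]

lemma taylor_restrictLine (a b : Fin m → F) (t : F) (P : MvPolynomial (Fin m) F) :
    Polynomial.taylor t (restrictLine a b P) =
      aeval (fun k => Polynomial.C (b k) * Polynomial.X) (translate (a + t • b) P) := by
  have h : (Polynomial.taylorAlgHom t).comp ((restrictLine a b)) =
      ((aeval (fun k => Polynomial.C (b k) * Polynomial.X)).comp (translate (a + t • b)) :
        MvPolynomial (Fin m) F →ₐ[F] Polynomial F) := by
    apply algHom_ext
    intro k
    simp [translate, restrictLine, Polynomial.taylor_apply]
    ring
  exact DFunLike.congr_fun h P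

/-- The Taylor expansion on the line is the multivariate one at a + tb with Z = Tb, so its T^j
coefficient collects the weight-j terms. Applied to P^{(l)} with `hasse_hasse`, this is the formula
defining `lineWord`. -/
lemma eval_hasseDeriv_restrictLine (a b : Fin m → F) (t : F) (P : MvPolynomial (Fin m) F) (j : ℕ) :
    (Polynomial.hasseDeriv j (restrictLine a b P)).eval t =
      ∑ i ∈ Finset.finsuppAntidiag (Finset.univ : Finset (Fin m)) j,
        eval (a + t • b) (hasse i P) * ∏ k, b k ^ i k := by
  rw [← Polynomial.taylor_coeff, taylor_restrictLine, coeff_aeval_C_mul_X]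
  simp only [eval_hasse]

lemma coeff_restrictLine (a b : Fin m → F) (P : MvPolynomial (Fin m) F) (j : ℕ) :
    (restrictLine a b P).coeff j =
      ∑ i ∈ Finset.finsuppAntidiag (Finset.univ : Finset (Fin m)) j,
        eval a (hasse i P) * ∏ k, b k ^ i k := by
  have := taylor_restrictLine a b 0 P
  rw [Polynomial.taylor_zero] at this
  rw [this, coeff_aeval_C_mul_X]
  simp only [eval_hasse, zero_smul, add_zero]

lemma eval_homogeneous (b : Fin m → F) (G : MvPolynomial (Fin m) F) (j : ℕ) :
    eval b (homogeneousComponent j G) =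
      ∑ i ∈ Finset.finsuppAntidiag (Finset.univ : Finset (Fin m)) j, coeff i G * ∏ k, b k ^ i k := by
  rw [← coeff_aeval_C_mul_X]
  induction G using MvPolynomial.induction_on' with
  | add p q hp hq => simp only [map_add, Polynomial.coeff_add, hp, hq]
  | monomial e r =>
    rw [coeff_aeval_C_mul_X]
    simp only [coeff_monomial, ite_mul, zero_mul, Finset.sum_ite_eq, Finset.mem_finsuppAntidiag]
    have : homogeneousComponent j (monomial e r) = if e.degree = j then monomial e r else 0 := by
      ext n
      rw [coeff_homogeneousComponent]
      split_ifs with h1 h2 h2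
      · rfl
      · rw [coeff_monomial, if_neg, coeff_zero]
        rintro rfl
        exact h2 h1
      · rw [coeff_monomial, if_neg]
        rintro rfl
        exact h1 h2
      · simp
    rw [this]
    split_ifs with h1 h2 h2
    · rw [eval_monomial, Finsupp.prod_fintype _ _ (by simp)]
    · exact absurd ⟨(Finsupp.degree_eq_sum e).symm.trans h1, by simp⟩ h2
    · exact absurd ((Finsupp.degree_eq_sum e).trans h2.1) h1
    · simp

lemma hasse_homogeneousComponent (l : Fin m →₀ ℕ) (j : ℕ) (P : MvPolynomial (Fin m) F) :
    hasse l (homogeneousComponent (l.degree + j) P) = homogeneousComponent j (hasse l P) := by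
  ext n
  rw [coeff_hasse, coeff_homogeneousComponent, coeff_homogeneousComponent, coeff_hasse]
  simp

lemma hasse_eq_zero_of_totalDegree_lt {l : Fin m →₀ ℕ} {P : MvPolynomial (Fin m) F}
    (h : P.totalDegree < l.degree) : hasse l P = 0 := by
  ext n
  rw [coeff_hasse, coeff_zero, coeff_eq_zero_of_totalDegree_lt, mul_zero]
  refine h.trans_le ?_
  rw [← Finsupp.degree_apply, map_add]
  exact Nat.le_add_right _ _

/-- On the line through `a` in direction `b`, the Taylor expansion of `P^{(l)}` at `a` agrees with
the Hasse derivatives at `b` of the homogeneous parts of `P(a + X)`. -/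
lemma eval_hasse_homogeneousComponent_translate (a b : Fin m → F) (l : Fin m →₀ ℕ) (j : ℕ)
    (P : MvPolynomial (Fin m) F) :
    eval b (hasse l (homogeneousComponent (l.degree + j) (translate a P))) =
      (restrictLine a b (hasse l P)).coeff j := by
  rw [hasse_homogeneousComponent, eval_homogeneous, coeff_restrictLine]
  refine Finset.sum_congr rfl fun i _ => ?_
  rw [hasse_hasse, coeff_hasse, map_mul, eval_C, ← eval_hasse]

lemma restrictLine_hasse_mem_degreeLT (a b : Fin m → F) (l : Fin m →₀ ℕ) {d : ℕ}
    {P : MvPolynomial (Fin m) F} (hP : P.totalDegree ≤ d) :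
    restrictLine a b (hasse l P) ∈ Polynomial.degreeLT F (d + 1 - l.degree) := by
  rw [Polynomial.mem_degreeLT, Polynomial.degree_lt_iff_coeff_zero]
  intro j hj
  rw [coeff_restrictLine]
  refine Finset.sum_eq_zero fun i hi => ?_
  -- The weight wt(l) + j exceeds d. This includes the case wt(l) > d, where the truncated bound is
  -- 0 and the restriction must be the zero polynomial.
  rw [hasse_hasse, hasse_eq_zero_of_totalDegree_lt, mul_zero, map_zero, zero_mul]
  have : i.degree = j := by
    rw [Finsupp.degree_eq_sum]
    exact (Finset.mem_finsuppAntidiag.1 hi).1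
  rw [map_add]
  omega

end Fin

/-! ### The Schwartz–Zippel lemma with multiplicities. -/

section SchwartzZippel

lemma sum_piFinset_succ {A : Type*} {n : ℕ} (S : Finset A) (f : (Fin (n + 1) → A) → ℕ) :
    ∑ α ∈ Fintype.piFinset (fun _ : Fin (n + 1) => S), f α =
      ∑ β ∈ Fintype.piFinset (fun _ : Fin n => S), ∑ x ∈ S, f (Fin.cons x β) := by
  rw [← Finset.sum_product']
  refine Finset.sum_nbij' (fun α => (Fin.tail α, α 0)) (fun p => Fin.cons p.2 p.1) ?_ ?_ ?_ ?_ ?_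
  · intro α hα
    rw [Fintype.mem_piFinset] at hα
    exact Finset.mem_product.2 ⟨Fintype.mem_piFinset.2 fun k => hα _, hα 0⟩
  · intro p hp
    rw [Finset.mem_product, Fintype.mem_piFinset] at hp
    rw [Fintype.mem_piFinset]
    exact Fin.cases hp.2 hp.1
  · intro α _
    simp
  · intro p _
    simp
  · intro α _
    simp

variable {F : Type*} [Field F]

/-- The pairwise coprime powers (X - x)^μ(x) all divide H. Hasse derivatives are Taylor
coefficients, so this holds in every characteristic. -/
lemma sum_multiplicity_le_natDegree {H : Polynomial F} (hH : H ≠ 0) (S : Finset F) (μ : F → ℕ)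
    (h : ∀ x ∈ S, ∀ j < μ x, (Polynomial.hasseDeriv j H).eval x = 0) :
    ∑ x ∈ S, μ x ≤ H.natDegree := by
  have hdvd : ∏ x ∈ S, (Polynomial.X - Polynomial.C x) ^ μ x ∣ H := by
    refine Finset.prod_dvd_of_coprime (fun x _ y _ hxy => ?_) fun x hx => ?_
    · exact (Polynomial.isCoprime_X_sub_C_of_isUnit_sub (sub_ne_zero.2 hxy).isUnit).pow
    · rw [Polynomial.X_sub_C_pow_dvd_iff, ← Polynomial.taylor_apply, Polynomial.X_pow_dvd_iff]
      intro j hj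
      rw [Polynomial.taylor_coeff, h x hx j hj]
  refine le_trans (le_of_eq ?_) (Polynomial.natDegree_le_of_dvd hdvd hH)
  rw [Polynomial.natDegree_prod_of_monic _ _ fun x _ => (Polynomial.monic_X_sub_C x).pow _]
  simp

lemma translate_neg_translate {σ : Type*} (a : σ → F) (P : MvPolynomial σ F) :
    translate (-a) (translate a P) = P := by
  have h : (translate (-a)).comp (translate a) = AlgHom.id F (MvPolynomial σ F) := by
    apply algHom_ext
    intro k
    simp [translate]
  exact DFunLike.congr_fun h P

lemma translate_ne_zero {σ : Type*} (a : σ → F) {P : MvPolynomial σ F} (hP : P ≠ 0) :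
    translate a P ≠ 0 := by
  intro h
  apply hP
  rw [← translate_neg_translate a P, h, map_zero]

/-- Translation by (x, β) splits into a Taylor shift in the distinguished variable and a translation
of the coefficients; this lets the induction treat the two separately. -/
lemma finSuccEquiv_translate {n : ℕ} (x : F) (a : Fin n → F) (G : MvPolynomial (Fin (n + 1)) F) :
    finSuccEquiv F n (translate (Fin.cons x a : Fin (n + 1) → F) G) =
      Polynomial.taylor (C x) ((finSuccEquiv F n G).map (translate a : _ →+* _)) := by
  have h : (finSuccEquiv F n : MvPolynomial (Fin (n + 1)) F →ₐ[F] _).comp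
        (translate (Fin.cons x a : Fin (n + 1) → F)) =
      (((Polynomial.taylorAlgHom (C x : MvPolynomial (Fin n) F)).restrictScalars F).comp
        (Polynomial.mapAlgHom (translate a))).comp
        (finSuccEquiv F n : MvPolynomial (Fin (n + 1)) F →ₐ[F] _) := by
    apply algHom_ext
    intro k
    refine Fin.cases ?_ (fun k => ?_) k
    · simp [translate, finSuccEquiv_apply, add_comm]
    · simp [translate, finSuccEquiv_apply]
  exact DFunLike.congr_fun h G

/-- The polynomial obtained by taking the `i`-th coefficient of each coefficient of `K`. -/
noncomputable def coeffSlice {σ : Type*} (i : σ →₀ ℕ) (K : Polynomial (MvPolynomial σ F)) :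
    Polynomial F :=
  ∑ k ∈ Finset.range (K.natDegree + 1), Polynomial.monomial k (coeff i (K.coeff k))

lemma coeff_coeffSlice {σ : Type*} (i : σ →₀ ℕ) (K : Polynomial (MvPolynomial σ F)) (k : ℕ) :
    (coeffSlice i K).coeff k = coeff i (K.coeff k) := by
  simp only [coeffSlice, Polynomial.finsetSum_coeff, Polynomial.coeff_monomial,
    Finset.sum_ite_eq', Finset.mem_range]
  split_ifs with h
  · rfl
  · rw [Polynomial.coeff_eq_zero_of_natDegree_lt (by omega), coeff_zero]

lemma natDegree_coeffSlice_le {σ : Type*} (i : σ →₀ ℕ) (K : Polynomial (MvPolynomial σ F)) :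
    (coeffSlice i K).natDegree ≤ K.natDegree := by
  rw [Polynomial.natDegree_le_iff_coeff_eq_zero]
  intro k hk
  rw [coeff_coeffSlice, Polynomial.coeff_eq_zero_of_natDegree_lt hk, coeff_zero]

lemma eval_hasseDeriv_coeffSlice {σ : Type*} (i : σ →₀ ℕ) (K : Polynomial (MvPolynomial σ F))
    (x : F) (j : ℕ) :
    (Polynomial.hasseDeriv j (coeffSlice i K)).eval x =
      coeff i ((Polynomial.taylor (C x) K).coeff j) := by
  rw [Polynomial.taylor_coeff]
  have h1 := natDegree_coeffSlice_le i K
  rw [Polynomial.hasseDeriv_apply, Polynomial.hasseDeriv_apply,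
    Polynomial.sum_over_range' _ _ (K.natDegree + 1) (by omega),
    Polynomial.sum_over_range' _ _ (K.natDegree + 1) (by omega)]
  · simp only [Polynomial.eval_finsetSum, Polynomial.eval_monomial, coeff_sum, coeff_coeffSlice]
    refine Finset.sum_congr rfl fun k _ => ?_
    rw [← C_pow, mul_comm _ (C _), coeff_C_mul, ← map_natCast (C : F →+* MvPolynomial σ F), coeff_C_mul]
    ring
  · simp
  · simp

/-- The Schwartz–Zippel lemma with multiplicities on the grid `S ^ n`. -/
theorem card_mul_sum_multiplicity_le (S : Finset F) : ∀ {n : ℕ} {G : MvPolynomial (Fin n) F},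
    G ≠ 0 → ∀ μ : (Fin n → F) → ℕ,
    (∀ α ∈ Fintype.piFinset (fun _ : Fin n => S), ∀ l : Fin n →₀ ℕ, l.degree < μ α →
      eval α (hasse l G) = 0) →
    S.card * ∑ α ∈ Fintype.piFinset (fun _ : Fin n => S), μ α ≤ G.totalDegree * S.card ^ n
  | 0, G, hG, μ, h => by
    have : ∀ α ∈ Fintype.piFinset (fun _ : Fin 0 => S), μ α = 0 := by
      intro α hα
      by_contra hμ
      have h0 := h α hα 0 (by rw [map_zero]; omega)
      rw [eval_hasse] at h0
      refine translate_ne_zero α hG (MvPolynomial.ext _ _ fun e => ?_)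
      rw [Subsingleton.elim e 0, h0, coeff_zero]
    rw [Finset.sum_eq_zero this, mul_zero]
    exact Nat.zero_le _
  | n + 1, G, hG, μ, h => by
    set K := finSuccEquiv F n G with hK
    have hK0 : K ≠ 0 := by
      rw [hK]
      exact (map_ne_zero_iff _ (finSuccEquiv F n).injective).2 hG
    have hlead : K.coeff K.natDegree ≠ 0 := by
      rwa [Polynomial.coeff_natDegree, Polynomial.leadingCoeff_ne_zero]
    -- A multi-index of least weight with nonvanishing derivative at β: its weight is the exact
    -- multiplicity of the leading coefficient at β, to which the induction hypothesis is applied.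
    have hmin : ∀ β : Fin n → F, ∃ i : Fin n →₀ ℕ,
        eval β (hasse i (K.coeff K.natDegree)) ≠ 0 ∧
        ∀ l : Fin n →₀ ℕ, l.degree < i.degree → eval β (hasse l (K.coeff K.natDegree)) = 0 := by
      intro β
      obtain ⟨i₀, hi₀⟩ := ne_zero_iff.1 (translate_ne_zero β hlead)
      have hex : ∃ w : ℕ, ∃ i : Fin n →₀ ℕ, i.degree = w ∧
          eval β (hasse i (K.coeff K.natDegree)) ≠ 0 :=
        ⟨_, i₀, rfl, by rwa [eval_hasse]⟩
      obtain ⟨i, hi, hne⟩ := Nat.find_spec hex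
      refine ⟨i, hne, fun l hl => ?_⟩
      by_contra hl0
      rw [hi] at hl
      exact Nat.find_min hex hl ⟨l, rfl, hl0⟩
    choose ι hι hιmin using hmin
    have hfib : ∀ β ∈ Fintype.piFinset (fun _ : Fin n => S),
        ∑ x ∈ S, μ (Fin.cons x β) ≤ K.natDegree + S.card * (ι β).degree := by
      intro β hβ
      set L := K.map (translate β : MvPolynomial (Fin n) F →+* MvPolynomial (Fin n) F) with hL
      have hLdeg : L.natDegree ≤ K.natDegree := Polynomial.natDegree_map_le
      -- The slice keeps the top coefficient of K, because the derivative of index ι β of the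
      -- leading coefficient does not vanish at β.
      have hH0 : coeffSlice (ι β) L ≠ 0 := by
        intro h0
        apply hι β
        rw [eval_hasse, ← coeff_zero (R := F) (ι β)]
        have := coeff_coeffSlice (ι β) L K.natDegree
        rw [h0, hL, Polynomial.coeff_map] at this
        rw [coeff_zero]
        exact this.symm
      -- The j-th derivative of the slice at x is the derivative of G at (x, β) of index (j, ι β).
      -- It vanishes when j + wt(ι β) < μ(x, β), so slicing loses at most wt(ι β) in multiplicity.
      have hsum := sum_multiplicity_le_natDegree hH0 S
        (fun x => μ (Fin.cons x β) - (ι β).degree) ?_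
      · calc ∑ x ∈ S, μ (Fin.cons x β)
            ≤ ∑ x ∈ S, ((μ (Fin.cons x β) - (ι β).degree) + (ι β).degree) :=
              Finset.sum_le_sum fun x _ => by omega
          _ ≤ K.natDegree + S.card * (ι β).degree := by
              rw [Finset.sum_add_distrib, Finset.sum_const, smul_eq_mul]
              have := natDegree_coeffSlice_le (ι β) L
              omega
      · intro x hx j hj
        rw [eval_hasseDeriv_coeffSlice, hL, hK, ← finSuccEquiv_translate, finSuccEquiv_coeff_coeff,
          ← eval_hasse]
        refine h _ ?_ _ ?_
        · rw [Fintype.mem_piFinset] at hβ ⊢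
          exact Fin.cases hx hβ
        · have : (Finsupp.cons j (ι β)).degree = j + (ι β).degree := by
            rw [Finsupp.degree_eq_sum, Finsupp.degree_eq_sum, Fin.sum_univ_succ]
            simp
          omega
    have ih := card_mul_sum_multiplicity_le S hlead (fun β => (ι β).degree)
      (fun β _ l hl => hιmin β l hl)
    have hdeg := totalDegree_coeff_finSuccEquiv_add_le G K.natDegree hlead
    rw [← hK] at hdeg
    rw [sum_piFinset_succ]
    calc S.card * ∑ β ∈ Fintype.piFinset (fun _ : Fin n => S), ∑ x ∈ S, μ (Fin.cons x β)
        ≤ S.card * ∑ β ∈ Fintype.piFinset (fun _ : Fin n => S),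
            (K.natDegree + S.card * (ι β).degree) := by
          gcongr with β hβ
          exact hfib β hβ
      _ = K.natDegree * S.card ^ (n + 1) + S.card * (S.card *
            ∑ β ∈ Fintype.piFinset (fun _ : Fin n => S), (ι β).degree) := by
          rw [Finset.sum_add_distrib, Finset.sum_const, ← Finset.mul_sum,
            Fintype.card_piFinset_const, smul_eq_mul]
          ring
      _ ≤ K.natDegree * S.card ^ (n + 1) +
            S.card * ((K.coeff K.natDegree).totalDegree * S.card ^ n) := by gcongr
      _ = ((K.coeff K.natDegree).totalDegree + K.natDegree) * S.card ^ (n + 1) := by ring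
      _ ≤ G.totalDegree * S.card ^ (n + 1) := by gcongr

end SchwartzZippel

/-! ### Transport of Schwartz–Zippel to affine grids. -/

section AffineGrid

variable {F : Type*} [Field F] {m : ℕ}

/-- The polynomial `R(z + ∑ j, X_j y_j)`. -/
noncomputable def affineSubst (z : Fin m → F) (y : Fin m → Fin m → F) :
    MvPolynomial (Fin m) F →ₐ[F] MvPolynomial (Fin m) F :=
  aeval (fun k => C (z k) + ∑ j, C (y j k) * X j)

lemma translate_affineSubst (z : Fin m → F) (y : Fin m → Fin m → F) (α : Fin m → F)
    (R : MvPolynomial (Fin m) F) :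
    translate α (affineSubst z y R) =
      aeval (fun k => ∑ j, C (y j k) * X j) (translate (z + ∑ j, α j • y j) R) := by
  have h : (translate α).comp (affineSubst z y) =
      ((aeval (fun k => ∑ j, C (y j k) * X j)).comp (translate (z + ∑ j, α j • y j)) :
        MvPolynomial (Fin m) F →ₐ[F] MvPolynomial (Fin m) F) := by
    apply algHom_ext
    intro k
    simp [translate, affineSubst, mul_add, Finset.sum_add_distrib, Finset.sum_apply, mul_comm,
      add_assoc]
  exact DFunLike.congr_fun h R

lemma coeff_aeval_linear_eq_zero {c : ℕ} (g : Fin m → MvPolynomial (Fin m) F)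
    (hg : ∀ k, (g k).IsHomogeneous 1) (G : MvPolynomial (Fin m) F)
    (hG : ∀ l : Fin m →₀ ℕ, l.degree < c → coeff l G = 0) (l : Fin m →₀ ℕ) (hl : l.degree < c) :
    coeff l (aeval g G) = 0 := by
  rw [G.as_sum, map_sum, coeff_sum]
  refine Finset.sum_eq_zero fun e he => ?_
  have h1 : c ≤ e.degree := by
    by_contra! h
    exact (mem_support_iff.1 he) (hG e h)
  refine ((isHomogeneous_monomial _ rfl).aeval g hg).coeff_eq_zero ?_
  omega

/-- After moving the base point to the origin the substitution is linear, so it preserves degrees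
and creates no terms of weight below c. -/
lemma eval_hasse_affineSubst_eq_zero {c : ℕ} (z : Fin m → F) (y : Fin m → Fin m → F)
    (α : Fin m → F) (R : MvPolynomial (Fin m) F)
    (h : ∀ l : Fin m →₀ ℕ, l.degree < c → eval (z + ∑ j, α j • y j) (hasse l R) = 0)
    (l : Fin m →₀ ℕ) (hl : l.degree < c) : eval α (hasse l (affineSubst z y R)) = 0 := by
  rw [eval_hasse, translate_affineSubst]
  refine coeff_aeval_linear_eq_zero _ (fun k => ?_) _ (fun l hl => ?_) l hl
  · exact IsHomogeneous.sum _ _ _ fun j _ => isHomogeneous_C_mul_X _ _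
  · rw [← eval_hasse]
    exact h l hl

/-- Independence of the y_j makes the affine map invertible, and substituting its inverse recovers
R. -/
lemma affineSubst_ne_zero (z : Fin m → F) {y : Fin m → Fin m → F} (hy : LinearIndependent F y)
    {R : MvPolynomial (Fin m) F} (hR : R ≠ 0) : affineSubst z y R ≠ 0 := by
  have hu : IsUnit (Matrix.of y) := Matrix.linearIndependent_rows_iff_isUnit.1 hy
  obtain ⟨W, hW⟩ := hu.exists_left_inv
  have h : (aeval (fun j => ∑ i, C (W i j) * (X i - C (z i)))).comp (affineSubst z y) =
      AlgHom.id F (MvPolynomial (Fin m) F) := by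
    apply algHom_ext
    intro k
    have h1 : ∀ i, ∑ j, C (σ := Fin m) (y j k) * C (W i j) = if i = k then 1 else 0 := by
      intro i
      have := congrFun (congrFun hW i) k
      rw [Matrix.mul_apply, Matrix.one_apply] at this
      simp only [Matrix.of_apply] at this
      simp only [mul_comm (C (y _ k)), ← map_mul, ← map_sum, this]
      split_ifs <;> simp
    simp only [affineSubst, AlgHom.comp_apply, aeval_X, map_add, map_sum, map_mul, algHom_C,
      AlgHom.id_apply, algebraMap_eq, Finset.mul_sum, ← mul_assoc]
    rw [Finset.sum_comm]
    simp_rw [← Finset.sum_mul, h1]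
    simp
  intro h0
  apply hR
  have := DFunLike.congr_fun h R
  rw [AlgHom.comp_apply, h0, map_zero] at this
  exact this.symm

lemma totalDegree_affineSubst_le (z : Fin m → F) (y : Fin m → Fin m → F)
    (R : MvPolynomial (Fin m) F) : (affineSubst z y R).totalDegree ≤ R.totalDegree := by
  rw [affineSubst, aeval_def, eval₂_eq]
  refine totalDegree_finsetSum_le fun e he => ?_
  rw [algebraMap_eq]
  refine (totalDegree_mul _ _).trans ?_
  rw [totalDegree_C, zero_add]
  refine (totalDegree_finsetProd _ _).trans ?_
  refine le_trans (Finset.sum_le_sum fun k _ => ?_) (le_totalDegree he)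
  refine (totalDegree_pow _ _).trans ?_
  refine (Nat.mul_le_mul_left _ (?_ : _ ≤ 1)).trans (mul_one _).le
  refine (totalDegree_add _ _).trans (max_le (by simp) ?_)
  exact (IsHomogeneous.sum _ _ _ fun j _ => isHomogeneous_C_mul_X _ _).totalDegree_le

lemma injective_grid (z : Fin m → F) {y : Fin m → Fin m → F} (hy : LinearIndependent F y) :
    Function.Injective (fun α : Fin m → F => z + ∑ j, α j • y j) := by
  intro α β h
  exact hy.fintypeLinearCombination_injective (add_left_cancel h)

lemma card_directions (S : Finset F) (z : Fin m → F) {y : Fin m → Fin m → F}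
    (hy : LinearIndependent F y) : (directions S z y).card = S.card ^ m := by
  rw [directions, Finset.card_image_of_injective _ (injective_grid z hy),
    Fintype.card_piFinset_const]

/-- A nonzero polynomial vanishes to order `c` at few points of an affine grid. -/
theorem card_mul_card_filter_directions_le (S : Finset F) (z : Fin m → F) {y : Fin m → Fin m → F}
    (hy : LinearIndependent F y) {R : MvPolynomial (Fin m) F} (hR : R ≠ 0) (c : ℕ) :
    S.card * (c * ((directions S z y).filter
      (fun b => ∀ l : Fin m →₀ ℕ, l.degree < c → eval b (hasse l R) = 0)).card) ≤
      R.totalDegree * S.card ^ m := by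
  have h := card_mul_sum_multiplicity_le S (affineSubst_ne_zero z hy hR)
    (fun α => if ∀ l : Fin m →₀ ℕ, l.degree < c → eval (z + ∑ j, α j • y j) (hasse l R) = 0
      then c else 0) ?_
  · refine le_trans (le_of_eq ?_) (h.trans (Nat.mul_le_mul_right _
      (totalDegree_affineSubst_le z y R)))
    rw [directions, Finset.filter_image, Finset.card_image_of_injective _ (injective_grid z hy),
      ← Finset.sum_filter, Finset.sum_const, smul_eq_mul, mul_comm c]
  · intro α _ l hl
    split_ifs at hl with hα
    · exact eval_hasse_affineSubst_eq_zero z y α R hα l hl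
    · omega

end AffineGrid

/-! ### Unique decoding on lines and the combination step. -/

section Decoding

lemma five_mul_le_card_mul_ordC {A : Type*} {s d q : ℕ} {δ₀ : ℝ} {S : Finset A}
    (hS : S.card = gridSize s d q δ₀) :
    5 * s ≤ S.card * ordC s d q δ₀ := by
  have h := Nat.le_ceil (5 * (s : ℝ) / (ordC s d q δ₀ : ℝ))
  rw [div_le_iff₀ (by exact_mod_cast Nat.succ_pos _)] at h
  rw [hS, gridSize]
  exact_mod_cast h

variable {F : Type*} [Field F] {m s d : ℕ} {δ₀ : ℝ}

lemma findUnique_eq_some {α : Type*} {p : α → Prop} {x : α} (hx : p x) (h : ∀ y, p y → y = x) :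
    findUnique p = some x := by
  have hex : ∃! x, p x := ⟨x, hx, h⟩
  rw [findUnique, dif_pos hex]
  exact congrArg some (h _ hex.choose_spec.1)

lemma relDist_lt_iff {ι A : Type*} [Fintype ι] [Nonempty ι] [DecidableEq A] (x y : ι → A) (e : ℝ) :
    relDist x y < e ↔ (hammingDist x y : ℝ) < e * Fintype.card ι := by
  have h : relDist x y = (hammingDist x y : ℝ) / Fintype.card ι := by
    unfold relDist
    congr!
  rw [h, div_lt_iff₀ (by exact_mod_cast Fintype.card_pos)]

lemma delta_le_one (s d q : ℕ) : delta s d q ≤ 1 := by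
  have : (0 : ℝ) ≤ (d : ℝ) / ((s : ℝ) * (q : ℝ)) := by positivity
  rw [delta]
  linarith

lemma one_sub_pos_of_lt_delta {q : ℕ} (h : δ₀ < delta s d q / 8) : 0 < 1 - 8 * δ₀ := by
  linarith [delta_le_one s d q]

lemma gam_pos {q : ℕ} (h : δ₀ < delta s d q / 8) : 0 < gam s d q δ₀ :=
  div_pos (by linarith) (one_sub_pos_of_lt_delta h)

lemma lineWord_eq_uniEnc {P : MvPolynomial (Fin m) F} {r : (Fin m → F) → Alphabet F m s}
    {a b : Fin m → F} {t : F} (h : r (a + t • b) = enc s P (a + t • b)) (l : Fin m →₀ ℕ) :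
    lineWord r a b l t = uniEnc (s - l.degree) (restrictLine a b (hasse l P)) t := by
  funext j
  rw [lineWord, uniEnc, eval_hasseDeriv_restrictLine]
  refine Finset.sum_congr rfl fun i hi => ?_
  have hdeg : (l + i).degree < s := by
    have h1 : i.degree = j := by
      rw [Finsupp.degree_eq_sum]
      exact (Finset.mem_finsuppAntidiag.1 hi).1
    have := j.2
    rw [map_add]
    omega
  rw [symbolCoord, dif_pos hdeg, h, enc, orderEval, hasse_hasse, map_mul, eval_C]

variable [Fintype F]

lemma card_pos_real : (0 : ℝ) < Fintype.card F := by
  exact_mod_cast Fintype.card_pos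

/-- This is where γ comes from: (1 - γ)(1 - 8δ₀) = 1 - δ, so for w ≤ γs the product (s - w)(1 -
8δ₀)q is still at least (1 - δ)sq = d. -/
lemma le_of_lt_ordC (hs : 0 < s) (hδ : δ₀ < delta s d (Fintype.card F) / 8) {w : ℕ}
    (hw : w < ordC s d (Fintype.card F) δ₀) :
    w ≤ s ∧ (d : ℝ) ≤ ((s - w : ℕ) : ℝ) * ((1 - 8 * δ₀) * Fintype.card F) := by
  have hq := card_pos_real (F := F)
  set q := Fintype.card F
  have hs' : (0 : ℝ) < s := by exact_mod_cast hs
  have h1 := one_sub_pos_of_lt_delta hδ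
  have hγ := gam_pos hδ
  have hw' : (w : ℝ) ≤ gam s d q δ₀ * s :=
    (Nat.le_floor_iff (by positivity)).1 (Nat.lt_succ_iff.1 hw)
  have hγ1 : gam s d q δ₀ * (1 - 8 * δ₀) = delta s d q - 8 * δ₀ := div_mul_cancel₀ _ h1.ne'
  have hd : (d : ℝ) = (1 - delta s d q) * s * q := by
    rw [delta]
    field_simp
    ring
  have hγle : gam s d q δ₀ ≤ 1 := by
    rw [gam, div_le_one h1]
    linarith [delta_le_one s d q]
  have hws : w ≤ s := by
    have : (w : ℝ) ≤ s := hw'.trans (by nlinarith)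
    exact_mod_cast this
  refine ⟨hws, ?_⟩
  rw [Nat.cast_sub hws, hd, ← mul_assoc]
  refine mul_le_mul_of_nonneg_right ?_ hq.le
  calc (1 - delta s d q) * s = (s - gam s d q δ₀ * s) * (1 - 8 * δ₀) := by
        linear_combination (s : ℝ) * hγ1
    _ ≤ (s - w) * (1 - 8 * δ₀) := by gcongr

/-- The number of points on the line through `a` in direction `b` at which `r` is not the
evaluation of `P`. -/
noncomputable def lineErrors (P : MvPolynomial (Fin m) F) (r : (Fin m → F) → Alphabet F m s)
    (a b : Fin m → F) : ℕ :=
  (Finset.univ.filter fun t : F => r (a + t • b) ≠ enc s P (a + t • b)).card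

lemma hammingDist_uniEnc_lineWord_le (P : MvPolynomial (Fin m) F)
    (r : (Fin m → F) → Alphabet F m s) (a b : Fin m → F) (l : Fin m →₀ ℕ) :
    hammingDist (uniEnc (s - l.degree) (restrictLine a b (hasse l P))) (lineWord r a b l) ≤
      lineErrors P r a b := by
  refine Finset.card_le_card fun t ht => ?_
  simp only [Finset.mem_filter, Finset.mem_univ, true_and] at ht ⊢
  exact fun h => ht (lineWord_eq_uniEnc h l).symm

/-- The minimum distance of the univariate multiplicity codes used on the lines. -/
lemma eq_of_hammingDist_uniEnc_lt (hs : 0 < s) (hδ : δ₀ < delta s d (Fintype.card F) / 8) {w : ℕ}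
    (hw : w < ordC s d (Fintype.card F) δ₀) {Q Q' : Polynomial F}
    (hQ : Q ∈ Polynomial.degreeLT F (d + 1 - w)) (hQ' : Q' ∈ Polynomial.degreeLT F (d + 1 - w))
    (h : (hammingDist (uniEnc (s - w) Q) (uniEnc (s - w) Q') : ℝ) < 8 * δ₀ * Fintype.card F) :
    Q = Q' := by
  by_contra hne
  have hD : Q - Q' ≠ 0 := sub_ne_zero.2 hne
  have hdeg : (Q - Q').natDegree < d + 1 - w := by
    have := Submodule.sub_mem _ hQ hQ'
    rw [Polynomial.mem_degreeLT] at this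
    exact (Polynomial.natDegree_lt_iff_degree_lt hD).2 this
  obtain ⟨hws, hd⟩ := le_of_lt_ordC hs hδ hw
  have hq := card_pos_real (F := F)
  have hmult := sum_multiplicity_le_natDegree hD
    (Finset.univ.filter fun t : F => uniEnc (s - w) Q t = uniEnc (s - w) Q' t) (fun _ => s - w) ?_
  · rw [Finset.sum_const, smul_eq_mul] at hmult
    have hcard : (Finset.univ.filter fun t : F => uniEnc (s - w) Q t = uniEnc (s - w) Q' t).card +
        hammingDist (uniEnc (s - w) Q) (uniEnc (s - w) Q') = Fintype.card F := by
      rw [hammingDist, Finset.card_filter_add_card_filter_not, Finset.card_univ]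
    set A := (Finset.univ.filter fun t : F => uniEnc (s - w) Q t = uniEnc (s - w) Q' t).card
    have hA : (1 - 8 * δ₀) * Fintype.card F < A := by
      have : (A : ℝ) + hammingDist (uniEnc (s - w) Q) (uniEnc (s - w) Q') = Fintype.card F := by
        exact_mod_cast hcard
      linarith
    -- Q - Q' vanishes to order s - w at each of the A agreement points and has degree at most d -
    -- w.
    have hle : A * (s - w) ≤ d := by omega
    have hle' : (A : ℝ) * ((s - w : ℕ) : ℝ) ≤ d := by exact_mod_cast hle
    -- If w = s the code has empty alphabet. Then d = 0 < w, so the degree bound alone excludes a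
    -- nonzero difference.
    rcases Nat.eq_zero_or_pos (s - w) with h0 | hpos
    · rw [h0, Nat.cast_zero, zero_mul] at hd
      have : d = 0 := by
        have : (d : ℝ) = 0 := le_antisymm hd (by positivity)
        exact_mod_cast this
      omega
    · have hpos' : (0 : ℝ) < ((s - w : ℕ) : ℝ) := by exact_mod_cast hpos
      have := mul_lt_mul_of_pos_left hA hpos'
      linarith [mul_comm (A : ℝ) ((s - w : ℕ) : ℝ)]
  · intro t ht j hj
    rw [map_sub, Polynomial.eval_sub, sub_eq_zero]
    exact congrFun (Finset.mem_filter.1 ht).2 ⟨j, hj⟩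

/-- The restriction of P^{(l)} is within 4δ₀ of the received word, and any other candidate would be
within 8δ₀ of it by the triangle inequality. -/
lemma decodeLine_eq_some (hs : 0 < s) (hδ : δ₀ < delta s d (Fintype.card F) / 8)
    {P : MvPolynomial (Fin m) F} (hP : P.totalDegree ≤ d) {r : (Fin m → F) → Alphabet F m s}
    {a b : Fin m → F} (hb : (lineErrors P r a b : ℝ) < 4 * δ₀ * Fintype.card F)
    {l : Fin m →₀ ℕ} (hl : l.degree < ordC s d (Fintype.card F) δ₀) :
    decodeLine d δ₀ r a b l = some (restrictLine a b (hasse l P)) := by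
  have hq := card_pos_real (F := F)
  have hdist : (hammingDist (uniEnc (s - l.degree) (restrictLine a b (hasse l P)))
      (lineWord r a b l) : ℝ) < 4 * δ₀ * Fintype.card F :=
    lt_of_le_of_lt (by exact_mod_cast hammingDist_uniEnc_lineWord_le P r a b l) hb
  refine findUnique_eq_some ⟨restrictLine_hasse_mem_degreeLT a b l hP, ?_⟩ ?_
  · rwa [relDist_lt_iff]
  · rintro Q ⟨hQ, hQd⟩
    rw [relDist_lt_iff] at hQd
    refine eq_of_hammingDist_uniEnc_lt hs hδ hl hQ (restrictLine_hasse_mem_degreeLT a b l hP) ?_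
    have h1 := hammingDist_triangle_right (uniEnc (s - l.degree) Q)
      (uniEnc (s - l.degree) (restrictLine a b (hasse l P))) (lineWord r a b l)
    have h2 : (hammingDist (uniEnc (s - l.degree) Q)
        (uniEnc (s - l.degree) (restrictLine a b (hasse l P))) : ℝ) ≤
        hammingDist (uniEnc (s - l.degree) Q) (lineWord r a b l) +
        hammingDist (uniEnc (s - l.degree) (restrictLine a b (hasse l P))) (lineWord r a b l) := by
      exact_mod_cast h1
    linarith

lemma lineValue_eq_some (hs : 0 < s) (hδ : δ₀ < delta s d (Fintype.card F) / 8)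
    {P : MvPolynomial (Fin m) F} (hP : P.totalDegree ≤ d) {r : (Fin m → F) → Alphabet F m s}
    {a b : Fin m → F} (hb : (lineErrors P r a b : ℝ) < 4 * δ₀ * Fintype.card F)
    {l : Fin m →₀ ℕ} (hl : l.degree < ordC s d (Fintype.card F) δ₀) (j : ℕ) :
    lineValue d δ₀ r a j b l =
      some (eval b (hasse l (homogeneousComponent j (translate a P)))) := by
  rw [lineValue]
  split_ifs with h
  · obtain ⟨k, rfl⟩ := Nat.exists_eq_add_of_le h
    rw [decodeLine_eq_some hs hδ hP hb hl, Option.map_some,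
      eval_hasse_homogeneousComponent_translate, Nat.add_sub_cancel_left]
  -- For j < wt(l) the default value 0 is right, since the derivative of a form of degree j
  -- vanishes.
  · rw [hasse_eq_zero_of_totalDegree_lt, map_zero]
    exact (homogeneousComponent_isHomogeneous j _).totalDegree_le.trans_lt (not_le.1 h)

/-- Two sets of at least 2/3 of B meet in at least 1/3 of B, where R - R' vanishes to order c. If R
≠ R', Schwartz–Zippel gives |S|c/3 ≤ j < s, against |S|c ≥ 5s. -/
lemma isCombination_unique {S : Finset F} (hS : S.card = gridSize s d (Fintype.card F) δ₀)
    {r : (Fin m → F) → Alphabet F m s} {a z : Fin m → F} {y : Fin m → Fin m → F}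
    (hy : LinearIndependent F y) {j : ℕ} (hj : j < s) {R R' : MvPolynomial (Fin m) F}
    (hR : IsCombination d δ₀ r a (directions S z y) j R)
    (hR' : IsCombination d δ₀ r a (directions S z y) j R') : R = R' := by
  by_contra hne
  have hD : R - R' ≠ 0 := sub_ne_zero.2 hne
  have hdeg : (R - R').totalDegree ≤ j := (hR.1.sub hR'.1).totalDegree_le
  have h := card_mul_card_filter_directions_le S z hy hD (ordC s d (Fintype.card F) δ₀)
  have h5 := five_mul_le_card_mul_ordC hS
  have hR2 := hR.2
  have hR2' := hR'.2
  rw [← card_directions S z hy] at h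
  have hpos : 0 < (directions S z y).card := by
    rw [card_directions S z hy]
    refine pow_pos (Nat.pos_of_ne_zero fun h0 => ?_) _
    rw [h0, zero_mul] at h5
    omega
  have hsub : (directions S z y).card ≤ 3 * ((directions S z y).filter
      (fun b => ∀ l : Fin m →₀ ℕ, l.degree < ordC s d (Fintype.card F) δ₀ →
        eval b (hasse l (R - R')) = 0)).card := by
    refine le_trans ?_ (Nat.mul_le_mul_left 3 (Finset.card_le_card
      (s := (directions S z y).filter (fun b => ∀ l : Fin m →₀ ℕ,
          l.degree < ordC s d (Fintype.card F) δ₀ →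
          lineValue d δ₀ r a j b l = some (MvPolynomial.eval b (hasse l R))) ∩
        (directions S z y).filter (fun b => ∀ l : Fin m →₀ ℕ,
          l.degree < ordC s d (Fintype.card F) δ₀ →
          lineValue d δ₀ r a j b l = some (MvPolynomial.eval b (hasse l R')))) ?_))
    · have h1 := Finset.card_union_add_card_inter
        ((directions S z y).filter (fun b => ∀ l : Fin m →₀ ℕ,
          l.degree < ordC s d (Fintype.card F) δ₀ →
          lineValue d δ₀ r a j b l = some (MvPolynomial.eval b (hasse l R))))
        ((directions S z y).filter (fun b => ∀ l : Fin m →₀ ℕ,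
          l.degree < ordC s d (Fintype.card F) δ₀ →
          lineValue d δ₀ r a j b l = some (MvPolynomial.eval b (hasse l R'))))
      have h2 := Finset.card_le_card (Finset.union_subset
        (Finset.filter_subset (fun b => ∀ l : Fin m →₀ ℕ,
          l.degree < ordC s d (Fintype.card F) δ₀ →
          lineValue d δ₀ r a j b l = some (MvPolynomial.eval b (hasse l R))) (directions S z y))
        (Finset.filter_subset (fun b => ∀ l : Fin m →₀ ℕ,
          l.degree < ordC s d (Fintype.card F) δ₀ →
          lineValue d δ₀ r a j b l = some (MvPolynomial.eval b (hasse l R'))) (directions S z y)))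
      omega
    · intro b hb
      simp only [Finset.mem_inter, Finset.mem_filter] at hb ⊢
      refine ⟨hb.1.1, fun l hl => ?_⟩
      have := (hb.1.2 l hl).symm.trans (hb.2.2 l hl)
      rw [hasse, map_sub, coeff_sub, map_sub, sub_eq_zero]
      exact Option.some_injective _ this
  set N := (directions S z y).card
  set T := ((directions S z y).filter
      (fun b => ∀ l : Fin m →₀ ℕ, l.degree < ordC s d (Fintype.card F) δ₀ →
        eval b (hasse l (R - R')) = 0)).card
  have : 5 * s * N ≤ 3 * j * N := by
    calc 5 * s * N ≤ (S.card * ordC s d (Fintype.card F) δ₀) * (3 * T) :=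
          Nat.mul_le_mul h5 hsub
      _ = 3 * (S.card * (ordC s d (Fintype.card F) δ₀ * T)) := by ring
      _ ≤ 3 * (j * N) := Nat.mul_le_mul_left _ (h.trans (Nat.mul_le_mul_right _ hdeg))
      _ = 3 * j * N := by ring
  have := Nat.le_of_mul_le_mul_right this hpos
  omega

/-- If the directions are in general position and on at least `2/3` of them the line has few
errors, then the combination step is correct. -/
theorem combine_eq_some (hs : 0 < s) (hδ : δ₀ < delta s d (Fintype.card F) / 8)
    {S : Finset F} (hS : S.card = gridSize s d (Fintype.card F) δ₀)
    {P : MvPolynomial (Fin m) F} (hP : P.totalDegree ≤ d) {r : (Fin m → F) → Alphabet F m s}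
    {a z : Fin m → F} {y : Fin m → Fin m → F} (hy : LinearIndependent F y)
    (hgood : 2 * (directions S z y).card ≤ 3 * ((directions S z y).filter
      (fun b => (lineErrors P r a b : ℝ) < 4 * δ₀ * Fintype.card F)).card) :
    combine d δ₀ r a (directions S z y) = some (orderEval s P a) := by
  have hcomb : ∀ j : ℕ, IsCombination d δ₀ r a (directions S z y) j
      (homogeneousComponent j (translate a P)) := by
    refine fun j => ⟨homogeneousComponent_isHomogeneous j _, hgood.trans
      (Nat.mul_le_mul_left 3 (Finset.card_le_card fun b hb => ?_))⟩
    simp only [Finset.mem_filter] at hb ⊢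
    exact ⟨hb.1, fun l hl => lineValue_eq_some hs hδ hP hb.2 hl j⟩
  have hex : ∀ j : Fin s, ∃! R : MvPolynomial (Fin m) F,
      IsCombination d δ₀ r a (directions S z y) (j : ℕ) R := fun j =>
    ⟨_, hcomb j, fun R hR => isCombination_unique hS hy j.2 hR (hcomb j)⟩
  rw [combine, dif_pos hex]
  congr 1
  funext i
  rw [isCombination_unique hS hy i.2 (hex ⟨i.1.degree, i.2⟩).choose_spec.1 (hcomb _),
    coeff_homogeneousComponent, if_pos rfl, orderEval, eval_hasse]

end Decoding

/-! ### Uniform probability and Cantelli's inequality. -/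

section Probability

variable {Ω : Type*} [Fintype Ω]

lemma uniformProb_eq (p : Ω → Prop) [DecidablePred p] :
    uniformProb p = ((Finset.univ.filter p).card : ℝ) / Fintype.card Ω := by
  unfold uniformProb
  congr!

lemma uniformProb_nonneg (p : Ω → Prop) : 0 ≤ uniformProb p := by
  unfold uniformProb
  positivity

lemma uniformProb_mono {p q : Ω → Prop} (h : ∀ ω, p ω → q ω) : uniformProb p ≤ uniformProb q := by
  rw [uniformProb_eq, uniformProb_eq]
  gcongr with ω hω
  exact h ω

lemma uniformProb_or_le (p q : Ω → Prop) :
    uniformProb (fun ω => p ω ∨ q ω) ≤ uniformProb p + uniformProb q := by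
  rw [uniformProb_eq, uniformProb_eq, uniformProb_eq, ← add_div, Finset.filter_or]
  gcongr
  exact_mod_cast Finset.card_union_le _ _

lemma uniformProb_not [Nonempty Ω] (p : Ω → Prop) :
    uniformProb (fun ω => ¬ p ω) = 1 - uniformProb p := by
  have h : (0 : ℝ) < Fintype.card Ω := by exact_mod_cast Fintype.card_pos
  have h1 := Finset.card_filter_add_card_filter_not (s := (Finset.univ : Finset Ω)) p
  rw [Finset.card_univ] at h1
  have h2 : ((Finset.univ.filter p).card : ℝ) + (Finset.univ.filter fun ω => ¬ p ω).card =
      Fintype.card Ω := by exact_mod_cast h1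
  rw [uniformProb_eq, uniformProb_eq, eq_sub_iff_add_eq, ← add_div, div_eq_one_iff_eq h.ne']
  linarith

lemma uniformProb_le_one [Nonempty Ω] (p : Ω → Prop) : uniformProb p ≤ 1 := by
  linarith [uniformProb_nonneg (fun ω => ¬ p ω), uniformProb_not p]

lemma uniformProb_and_prod {A B : Type*} [Fintype A] [Fintype B] (p : A → Prop) (q : B → Prop) :
    uniformProb (fun x : A × B => p x.1 ∧ q x.2) = uniformProb p * uniformProb q := by
  rw [uniformProb_eq, uniformProb_eq, uniformProb_eq, Fintype.card_prod, ← Finset.univ_product_univ, Finset.filter_product, Finset.card_product]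
  push_cast
  rw [mul_div_mul_comm]

/-- A surjective homomorphism maps the uniform distribution to the uniform distribution. -/
lemma uniformProb_comp_of_surjective {G H : Type*} [AddGroup G] [AddGroup H] [Fintype G]
    [Fintype H] (f : G →+ H) (hf : Function.Surjective f) (p : H → Prop) :
    uniformProb (fun g => p (f g)) = uniformProb p := by
  set k := (Finset.univ.filter fun g : G => f g = 0).card with hk
  have hfib : ∀ h : H, (Finset.univ.filter fun g : G => f g = h).card = k := fun h =>
    AddMonoidHom.card_fiber_eq_of_mem_range f (hf h) (hf 0)
  have hcount : ∀ q : H → Prop, (Finset.univ.filter fun g : G => q (f g)).card =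
      (Finset.univ.filter q).card * k := by
    intro q
    rw [Finset.card_eq_sum_card_fiberwise (f := f) (t := Finset.univ.filter q)
      (fun g hg => by simpa using hg), ← smul_eq_mul, ← Finset.sum_const]
    refine Finset.sum_congr rfl fun h hh => ?_
    rw [← hfib h, Finset.filter_filter]
    congr 1
    refine Finset.filter_congr fun g _ => ⟨fun h => h.2, ?_⟩
    rintro rfl
    exact ⟨(Finset.mem_filter.1 hh).2, rfl⟩
  have hG : Fintype.card G = Fintype.card H * k := by
    have := hcount (fun _ => True)
    simpa using this
  have hk0 : (k : ℝ) ≠ 0 := by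
    have : 0 < Fintype.card H * k := hG ▸ Fintype.card_pos
    exact_mod_cast (Nat.pos_of_mul_pos_left this).ne'
  rw [uniformProb_eq, uniformProb_eq, hcount, hG]
  push_cast
  rw [mul_div_mul_right _ _ hk0]

lemma sum_ite_eq_uniformProb_mul [Nonempty Ω] (p : Ω → Prop) [DecidablePred p] :
    ∑ ω, (if p ω then (1 : ℝ) else 0) = uniformProb p * Fintype.card Ω := by
  have h : (Fintype.card Ω : ℝ) ≠ 0 := by exact_mod_cast Fintype.card_ne_zero
  rw [uniformProb_eq, div_mul_cancel₀ _ h, Finset.sum_boole]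

/-- Cantelli's inequality for the number of pairwise independent events that occur. -/
theorem uniformProb_card_gt_le [Nonempty Ω] {ι : Type*} (I : Finset ι) (bad : ι → Ω → Prop)
    {p θ : ℝ} (hp : ∀ i ∈ I, uniformProb (bad i) = p)
    (hpair : ∀ i ∈ I, ∀ j ∈ I, i ≠ j → uniformProb (fun ω => bad i ω ∧ bad j ω) = p * p)
    (hI : I.Nonempty) (hθ : p < θ) :
    uniformProb (fun ω => θ * I.card < (I.filter fun i => bad i ω).card) ≤
      p * (1 - p) / (p * (1 - p) + I.card * (θ - p) ^ 2) := by
  have hp01 : 0 ≤ p ∧ p ≤ 1 := by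
    obtain ⟨i, hi⟩ := hI
    exact ⟨hp i hi ▸ uniformProb_nonneg _, hp i hi ▸ uniformProb_le_one _⟩
  have hN : (0 : ℝ) < I.card := by exact_mod_cast hI.card_pos
  have hΩ : (0 : ℝ) < Fintype.card Ω := by exact_mod_cast Fintype.card_pos
  set N : ℝ := (I.card : ℝ)
  set M : ℝ := (Fintype.card Ω : ℝ)
  set V := p * (1 - p) with hV
  have hV0 : 0 ≤ V := mul_nonneg hp01.1 (by linarith [hp01.2])
  set D := θ - p with hD
  have hD0 : 0 < D := by linarith
  set K : Ω → ℝ := fun ω => ∑ i ∈ I, if bad i ω then (1 : ℝ) else 0 with hK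
  have hKcard : ∀ ω, ((I.filter fun i => bad i ω).card : ℝ) = K ω := fun ω => by
    simp only [hK, Finset.sum_boole]
  have hE1 : ∑ ω, K ω = N * p * M := by
    rw [hK, Finset.sum_comm, Finset.sum_congr rfl fun i hi => by
      rw [sum_ite_eq_uniformProb_mul, hp i hi], Finset.sum_const, nsmul_eq_mul]
    ring
  have hE2 : ∑ ω, K ω ^ 2 = (N * p + N * (N - 1) * (p * p)) * M := by
    have h1 : ∀ ω, K ω ^ 2 = ∑ i ∈ I, ∑ j ∈ I, if bad i ω ∧ bad j ω then (1 : ℝ) else 0 := by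
      intro ω
      rw [hK, sq, Finset.sum_mul_sum]
      refine Finset.sum_congr rfl fun i _ => Finset.sum_congr rfl fun j _ => ?_
      by_cases h1 : bad i ω <;> by_cases h2 : bad j ω <;> simp [h1, h2]
    simp_rw [h1]
    rw [Finset.sum_comm]
    -- The diagonal pair contributes p, and each of the N - 1 others p² by pairwise independence.
    have h2 : ∀ i ∈ I, ∑ ω, ∑ j ∈ I, (if bad i ω ∧ bad j ω then (1 : ℝ) else 0) =
        (p + (N - 1) * (p * p)) * M := by
      intro i hi
      rw [Finset.sum_comm, ← Finset.add_sum_erase _ _ hi]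
      have h3 : ∀ j ∈ I.erase i, ∑ ω, (if bad i ω ∧ bad j ω then (1 : ℝ) else 0) =
          p * p * M := fun j hj => by
        rw [sum_ite_eq_uniformProb_mul (fun ω => bad i ω ∧ bad j ω),
          hpair i hi j (Finset.mem_of_mem_erase hj) (Finset.ne_of_mem_erase hj).symm]
      rw [Finset.sum_congr rfl h3, Finset.sum_const, Finset.card_erase_of_mem hi, nsmul_eq_mul,
        Nat.cast_sub hI.card_pos]
      simp only [and_self]
      rw [sum_ite_eq_uniformProb_mul (bad i), hp i hi]
      push_cast
      ring
    rw [Finset.sum_congr rfl h2, Finset.sum_const, nsmul_eq_mul]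
    ring
  -- The shift that optimizes Markov's inequality for (K - Np + t)²: its mean is NV + t², and it is
  -- at least (ND + t)² on the event.
  set t := V / D with ht
  have ht0 : 0 ≤ t := div_nonneg hV0 hD0.le
  have hpos : 0 < N * D + t := by positivity
  have hmain : (N * D + t) ^ 2 * (uniformProb (fun ω => θ * N < (I.filter fun i =>
      bad i ω).card) * M) ≤ (N * V + t ^ 2) * M := by
    rw [← sum_ite_eq_uniformProb_mul, Finset.mul_sum]
    calc ∑ ω, (N * D + t) ^ 2 * (if θ * N < (I.filter fun i => bad i ω).card then (1 : ℝ) else 0)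
        ≤ ∑ ω, (K ω - N * p + t) ^ 2 := by
          refine Finset.sum_le_sum fun ω _ => ?_
          rw [hKcard]
          split_ifs with h
          · rw [mul_one]
            refine pow_le_pow_left₀ hpos.le ?_ 2
            rw [hD]
            linarith
          · rw [mul_zero]
            positivity
      _ = ∑ ω, (K ω ^ 2 + 2 * (t - N * p) * K ω + (t - N * p) ^ 2) :=
          Finset.sum_congr rfl fun ω _ => by ring
      _ = (N * V + t ^ 2) * M := by
          rw [Finset.sum_add_distrib, Finset.sum_add_distrib, ← Finset.mul_sum, hE1, hE2,
            Finset.sum_const, Finset.card_univ, nsmul_eq_mul, hV]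
          ring
  have hmain' := le_of_mul_le_mul_right (a := M) (by linarith [hmain]) hΩ
    (b := (N * D + t) ^ 2 * uniformProb (fun ω => θ * N < (I.filter fun i =>
      bad i ω).card)) (c := N * V + t ^ 2)
  have hden : 0 < V + N * D ^ 2 := by positivity
  have h1 : (N * D + t) ^ 2 * (V / (V + N * D ^ 2)) = N * V + t ^ 2 := by
    rw [ht]
    field_simp
    ring
  rw [← h1] at hmain'
  exact le_of_mul_le_mul_left hmain' (by positivity)

end Probability

/-- The numerical estimate behind the failure probability. -/
lemma failure_bound {N p ε η : ℝ} (hN : 0 < N) (hp0 : 0 ≤ p) (hp : p ≤ 1 / 4 + ε) (hε0 : 0 ≤ ε)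
    (hε : ε < 1 / 16) (hη : η ≤ 3 / 5 * ε) :
    p * (1 - p) / (p * (1 - p) + N * (1 / 3 - p) ^ 2) + η ≤ 27 / (N + 27) + 16 * ε := by
  -- V and D are p(1 - p) and 1/3 - p at the extreme value p = 1/4 + ε. At ε = 0 one has V/D² = 27.
  set V := 3 / 16 + ε / 2 - ε ^ 2 with hV
  set D := 1 / 12 - ε with hD
  have hV0 : 0 < V := by nlinarith
  have hD0 : 0 < D := by linarith
  have hden : 0 < V + N * D ^ 2 := by positivity
  have hpV : p * (1 - p) ≤ V := by nlinarith
  have hpD : D ≤ 1 / 3 - p := by linarith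
  have hpp : 0 ≤ p * (1 - p) := mul_nonneg hp0 (by linarith)
  have hsq : D ^ 2 ≤ (1 / 3 - p) ^ 2 := pow_le_pow_left₀ hD0.le hpD 2
  have h1 : p * (1 - p) / (p * (1 - p) + N * (1 / 3 - p) ^ 2) ≤ V / (V + N * D ^ 2) := by
    have : 0 < N * (1 / 3 - p) ^ 2 := mul_pos hN (pow_pos (hD0.trans_le hpD) 2)
    rw [div_le_div_iff₀ (by linarith) hden]
    have := mul_le_mul hpV hsq (by positivity) hV0.le
    nlinarith
  -- Here 77/5 = 16 - 3/5 is what remains of 16ε after η. The difference carries a factor ε because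
  -- V - 27D² = ε(5 - 28ε).
  have h2 : V / (V + N * D ^ 2) ≤ 27 / (N + 27) + 77 / 5 * ε := by
    have h3 : N * (5 - 28 * ε) ≤ 77 / 5 * ((V + N * D ^ 2) * (N + 27)) := by
      have h4 : 5 - 28 * ε ≤ 77 / 5 * (V + 27 * D ^ 2) := by
        rw [hV, hD]
        nlinarith [sq_nonneg (ε - 21 / 500)]
      have h5 : N * (V + 27 * D ^ 2) ≤ (V + N * D ^ 2) * (N + 27) := by
        have : 0 ≤ 27 * V + N ^ 2 * D ^ 2 := by positivity
        nlinarith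
      have := mul_le_mul_of_nonneg_left h4 hN.le
      nlinarith
    have h6 : 27 / (N + 27) + 77 / 5 * ε - V / (V + N * D ^ 2) =
        ε * (77 / 5 * ((V + N * D ^ 2) * (N + 27)) - N * (5 - 28 * ε)) /
          ((V + N * D ^ 2) * (N + 27)) := by
      have : N + 27 ≠ 0 := by positivity
      field_simp
      rw [hV, hD]
      ring
    have h7 : 0 ≤ 27 / (N + 27) + 77 / 5 * ε - V / (V + N * D ^ 2) := by
      rw [h6]
      exact div_nonneg (mul_nonneg hε0 (sub_nonneg.2 h3)) (by positivity)
    linarith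
  linarith

/-! ### Distribution of the random directions and of the errors on their lines. -/

section RandomDirections

variable {F : Type*} [Field F] {m s : ℕ}

/-- The direction with parameters `α`, as a homomorphism in the random choices. -/
def directionHom (α : Fin m → F) : (Fin m → F) × (Fin m → Fin m → F) →+ (Fin m → F) where
  toFun ω := ω.1 + ∑ j, α j • ω.2 j
  map_zero' := by simp
  map_add' := fun ω ω' => by
    simp only [Prod.fst_add, Prod.snd_add, Pi.add_apply, smul_add, Finset.sum_add_distrib]
    abel

lemma directionHom_surjective (α : Fin m → F) : Function.Surjective (directionHom α) :=
  fun u => ⟨(u, 0), by simp [directionHom]⟩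

/-- This yields pairwise independence. If α and β differ at k, then z and y_k alone suffice to solve
z + α_k y_k = u and z + β_k y_k = v. -/
lemma directionHom_prod_surjective {α β : Fin m → F} (h : α ≠ β) :
    Function.Surjective ((directionHom α).prod (directionHom β)) := by
  rintro ⟨u, v⟩
  obtain ⟨k, hk⟩ := Function.ne_iff.1 h
  have hk' := sub_ne_zero.2 hk
  have hsum : ∀ (γ w : Fin m → F), ∑ j, γ j • (Pi.single k w : Fin m → Fin m → F) j = γ k • w := by
    intro γ w
    rw [Finset.sum_eq_single k]
    · simp
    · intro j _ hj
      simp [Pi.single_eq_of_ne hj]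
    · simp
  refine ⟨(u - α k • ((α k - β k)⁻¹ • (u - v)), Pi.single k ((α k - β k)⁻¹ • (u - v))), ?_⟩
  simp only [AddMonoidHom.prod_apply, directionHom, AddMonoidHom.coe_mk, ZeroHom.coe_mk, hsum,
    Prod.mk.injEq]
  refine ⟨by abel, ?_⟩
  ext i
  simp only [Pi.add_apply, Pi.sub_apply, Pi.smul_apply, smul_eq_mul]
  field_simp
  ring

variable [Fintype F]

lemma uniformProb_direction (α : Fin m → F) (p : (Fin m → F) → Prop) :
    uniformProb (fun ω : (Fin m → F) × (Fin m → Fin m → F) => p (ω.1 + ∑ j, α j • ω.2 j)) =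
      uniformProb p :=
  uniformProb_comp_of_surjective (directionHom α) (directionHom_surjective α) p

lemma uniformProb_direction_and {α β : Fin m → F} (h : α ≠ β) (p : (Fin m → F) → Prop) :
    uniformProb (fun ω : (Fin m → F) × (Fin m → Fin m → F) =>
      p (ω.1 + ∑ j, α j • ω.2 j) ∧ p (ω.1 + ∑ j, β j • ω.2 j)) =
      uniformProb p * uniformProb p :=
  (uniformProb_comp_of_surjective _ (directionHom_prod_surjective h)
    (fun x => p x.1 ∧ p x.2)).trans (uniformProb_and_prod p p)

/-- By Cantelli's inequality, it is unlikely that more than a third of the parameters in the grid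
have a direction with property `p`. -/
lemma uniformProb_card_directions_gt_le {S : Finset F} (hS : 0 < S.card) (p : (Fin m → F) → Prop)
    (hp : uniformProb p < 1 / 3) :
    uniformProb (fun ω : (Fin m → F) × (Fin m → Fin m → F) => 1 / 3 * (S.card : ℝ) ^ m <
      ((Fintype.piFinset fun _ : Fin m => S).filter fun α => p (ω.1 + ∑ j, α j • ω.2 j)).card) ≤
      uniformProb p * (1 - uniformProb p) / (uniformProb p * (1 - uniformProb p) +
        (S.card : ℝ) ^ m * (1 / 3 - uniformProb p) ^ 2) := by
  have h := uniformProb_card_gt_le (Fintype.piFinset fun _ : Fin m => S)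
    (fun α (ω : (Fin m → F) × (Fin m → Fin m → F)) => p (ω.1 + ∑ j, α j • ω.2 j))
    (fun α _ => uniformProb_direction α p) (fun α _ β _ hαβ => uniformProb_direction_and hαβ p)
    (Finset.card_pos.1 (by rw [Fintype.card_piFinset_const]; exact pow_pos hS m)) hp
  rwa [Fintype.card_piFinset_const, Nat.cast_pow] at h

/-- Count pairs of α ≠ 0 and y with ∑ α_j y_j = 0. Each α occurs for a fraction q^{-m} of the y,
while a dependent y has at least q - 1 such α, the nonzero multiples of one relation. -/
lemma uniformProb_not_linearIndependent_le (hq : 1 < Fintype.card F) :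
    uniformProb (fun y : Fin m → Fin m → F => ¬ LinearIndependent F y) ≤
      1 / ((Fintype.card F : ℝ) - 1) := by
  set Y := Fintype.card (Fin m → Fin m → F) with hY
  have hYpos : (0 : ℝ) < Y := by exact_mod_cast Fintype.card_pos
  set comb : (Fin m → F) → (Fin m → Fin m → F) →+ (Fin m → F) := fun α =>
    (directionHom α).comp (AddMonoidHom.inr _ _) with hcomb
  have hcomb_apply : ∀ α y, comb α y = ∑ j, α j • y j := fun α y => by simp [hcomb, directionHom]
  have hsurj : ∀ α : Fin m → F, α ≠ 0 → Function.Surjective (comb α) := by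
    intro α hα u
    obtain ⟨k, hk⟩ := Function.ne_iff.1 hα
    refine ⟨Pi.single k ((α k)⁻¹ • u), ?_⟩
    rw [hcomb_apply, Finset.sum_eq_single k]
    · rw [Pi.single_eq_same, smul_smul, mul_inv_cancel₀ hk, one_smul]
    · intro j _ hj
      simp [Pi.single_eq_of_ne hj]
    · simp
  set r : (Fin m → F) → (Fin m → Fin m → F) → Prop := fun α y => comb α y = 0
  set nz : Finset (Fin m → F) := Finset.univ.filter fun α => α ≠ 0 with hnz
  have hdouble := Finset.sum_card_bipartiteAbove_eq_sum_card_bipartiteBelow r (s := nz)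
    (t := (Finset.univ : Finset (Fin m → Fin m → F)))
  have hleft : ∀ α ∈ nz, ((Finset.univ.bipartiteAbove r α).card : ℝ) =
      Y / Fintype.card (Fin m → F) := by
    intro α hα
    have h := uniformProb_comp_of_surjective (comb α) (hsurj α (Finset.mem_filter.1 hα).2)
      (fun u => u = 0)
    rw [uniformProb_eq, uniformProb_eq, Finset.filter_eq' Finset.univ (0 : Fin m → F), if_pos (Finset.mem_univ _),
      Finset.card_singleton, Nat.cast_one, div_eq_iff hYpos.ne'] at h
    rw [div_eq_mul_one_div, mul_comm, ← h]
    rfl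
  have hright : ∀ y : Fin m → Fin m → F, ¬ LinearIndependent F y →
      Fintype.card F - 1 ≤ (nz.bipartiteBelow r y).card := by
    intro y hy
    rw [Fintype.not_linearIndependent_iff] at hy
    obtain ⟨g, hg, i, hi⟩ := hy
    rw [← Finset.card_univ, ← Finset.card_erase_of_mem (Finset.mem_univ (0 : F))]
    refine Finset.card_le_card_of_injOn (fun t => t • g) (fun t ht => ?_) fun t _ t' _ h => ?_
    · simp only [Finset.coe_erase, Finset.coe_univ, Set.mem_sdiff, Set.mem_univ, true_and,
        Set.mem_singleton_iff] at ht
      simp only [Finset.bipartiteBelow, Finset.coe_filter, Set.mem_ofPred_eq, hnz,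
        Finset.mem_filter, Finset.mem_univ, true_and]
      refine ⟨fun h => ?_, ?_⟩
      · exact mul_ne_zero ht hi (congrFun h i)
      · change comb (t • g) y = 0
        rw [hcomb_apply]
        simp only [Pi.smul_apply, smul_eq_mul, mul_smul]
        rw [← Finset.smul_sum, hg, smul_zero]
    · exact mul_right_cancel₀ hi (congrFun h i)
  have hq' : (0 : ℝ) < (Fintype.card F : ℝ) - 1 := by
    rw [sub_pos]
    exact_mod_cast hq
  have hcount : ((Fintype.card F : ℝ) - 1) * (Finset.univ.filter fun y : Fin m → Fin m → F =>
      ¬ LinearIndependent F y).card ≤ Y := by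
    calc ((Fintype.card F : ℝ) - 1) * (Finset.univ.filter fun y : Fin m → Fin m → F =>
          ¬ LinearIndependent F y).card
        = ∑ y ∈ Finset.univ.filter (fun y : Fin m → Fin m → F => ¬ LinearIndependent F y),
            ((Fintype.card F : ℝ) - 1) := by
          rw [Finset.sum_const, nsmul_eq_mul, mul_comm]
      _ ≤ ∑ y ∈ Finset.univ.filter (fun y : Fin m → Fin m → F => ¬ LinearIndependent F y),
            ((nz.bipartiteBelow r y).card : ℝ) := by
          refine Finset.sum_le_sum fun y hy => ?_
          rw [sub_le_iff_le_add]
          have := hright y (Finset.mem_filter.1 hy).2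
          exact_mod_cast (by omega : Fintype.card F ≤ (nz.bipartiteBelow r y).card + 1)
      _ ≤ ∑ y : Fin m → Fin m → F, ((nz.bipartiteBelow r y).card : ℝ) :=
          Finset.sum_le_sum_of_subset_of_nonneg (Finset.filter_subset _ _)
            fun _ _ _ => by positivity
      _ = ∑ α ∈ nz, ((Finset.univ.bipartiteAbove r α).card : ℝ) := by exact_mod_cast hdouble.symm
      _ = nz.card * (Y / Fintype.card (Fin m → F)) := by
          rw [Finset.sum_congr rfl hleft, Finset.sum_const, nsmul_eq_mul]
      _ ≤ Fintype.card (Fin m → F) * (Y / Fintype.card (Fin m → F)) := by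
          gcongr
          exact Finset.card_le_univ _
      _ = Y := mul_div_cancel₀ _ (by exact_mod_cast Fintype.card_ne_zero)
  rw [uniformProb_eq, div_le_div_iff₀ hYpos hq', one_mul, mul_comm]
  exact hcount

/-- On a random line through `a`, at most a `δ₀` fraction of the points other than `a` are
erroneous on average. -/
lemma sum_lineErrors_le (P : MvPolynomial (Fin m) F) (r : (Fin m → F) → Alphabet F m s)
    (a : Fin m → F) :
    ∑ b, lineErrors P r a b ≤ Fintype.card (Fin m → F) +
      Fintype.card F * hammingDist (enc s P) r := by
  have h := Finset.sum_card_bipartiteAbove_eq_sum_card_bipartiteBelow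
    (fun (b : Fin m → F) (t : F) => r (a + t • b) ≠ enc s P (a + t • b))
    (s := Finset.univ) (t := Finset.univ)
  refine (le_of_eq h).trans ?_
  -- At t = 0 every line passes through a, which may be erroneous. For t ≠ 0 the map b ↦ a + tb is
  -- injective.
  rw [← Finset.add_sum_erase _ _ (Finset.mem_univ (0 : F))]
  refine add_le_add (Finset.card_le_univ _) ?_
  refine (Finset.sum_le_card_nsmul _ _ (hammingDist (enc s P) r) fun t ht => ?_).trans ?_
  · refine Finset.card_le_card_of_injOn (fun b => a + t • b) (fun b hb => ?_) fun b _ b' _ hbb => ?_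
    · simp only [Finset.bipartiteBelow, Finset.coe_filter, Set.mem_ofPred_eq, Finset.mem_univ,
        true_and] at hb ⊢
      exact hb.symm
    · exact smul_right_injective _ (Finset.ne_of_mem_erase ht) (add_left_cancel hbb)
  · rw [smul_eq_mul]
    exact Nat.mul_le_mul_right _ (Finset.card_le_univ _)

/-- Markov's inequality: the mean number of errors is at most 1 + δ₀q, and the 1 coming from t = 0
produces the second term. -/
lemma uniformProb_lineErrors_le {δ₀ : ℝ} {P : MvPolynomial (Fin m) F}
    {r : (Fin m → F) → Alphabet F m s} (hr : relDist (enc s P) r < δ₀) (hδ₀ : 0 < δ₀)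
    (a : Fin m → F) :
    uniformProb (fun b => ¬ (lineErrors P r a b : ℝ) < 4 * δ₀ * Fintype.card F) ≤
      1 / 4 + 1 / (4 * δ₀ * Fintype.card F) := by
  rw [relDist_lt_iff] at hr
  have hq := card_pos_real (F := F)
  have hM : (0 : ℝ) < Fintype.card (Fin m → F) := by exact_mod_cast Fintype.card_pos
  have hsum : (∑ b, (lineErrors P r a b : ℝ)) ≤ Fintype.card (Fin m → F) +
      Fintype.card F * hammingDist (enc s P) r := by exact_mod_cast sum_lineErrors_le P r a
  have hmarkov : (Finset.univ.filter fun b =>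
      ¬ (lineErrors P r a b : ℝ) < 4 * δ₀ * Fintype.card F).card * (4 * δ₀ * Fintype.card F) ≤
      ∑ b, (lineErrors P r a b : ℝ) := by
    rw [← nsmul_eq_mul, ← Finset.sum_const]
    refine (Finset.sum_le_sum fun b hb => not_lt.1 (Finset.mem_filter.1 hb).2).trans ?_
    exact Finset.sum_le_sum_of_subset_of_nonneg (Finset.filter_subset _ _)
      fun _ _ _ => by positivity
  have h1 : (1 / 4 + 1 / (4 * δ₀ * Fintype.card F)) * Fintype.card (Fin m → F) *
      (4 * δ₀ * Fintype.card F) = Fintype.card (Fin m → F) +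
      Fintype.card F * (δ₀ * Fintype.card (Fin m → F)) := by
    field_simp
    ring
  rw [uniformProb_eq, div_le_iff₀ hM]
  refine le_of_mul_le_mul_right ?_ (show 0 < 4 * δ₀ * (Fintype.card F : ℝ) by positivity)
  rw [h1]
  refine hmarkov.trans (hsum.trans ?_)
  have := mul_le_mul_of_nonneg_left hr.le hq.le
  linarith

end RandomDirections

/-! ### Query complexity and success probability. -/

section Correctness

lemma gridSize_le {s d q : ℕ} {δ₀ : ℝ} (hδ : δ₀ < delta s d q / 8) :
    gridSize s d q δ₀ ≤ ⌈5 / gam s d q δ₀⌉₊ := by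
  have hγ := gam_pos hδ
  refine Nat.ceil_mono ?_
  have hc : gam s d q δ₀ * s ≤ (ordC s d q δ₀ : ℝ) := by
    have := (Nat.lt_floor_add_one (gam s d q δ₀ * (s : ℝ))).le
    rw [ordC]
    exact_mod_cast this
  rw [div_le_div_iff₀ (by exact_mod_cast Nat.succ_pos _) hγ]
  linarith

variable {F : Type*} [Field F] {m s d : ℕ} {δ₀ : ℝ}

lemma card_directions_le (S : Finset F) (z : Fin m → F) (y : Fin m → Fin m → F) :
    (directions S z y).card ≤ S.card ^ m :=
  Finset.card_image_le.trans (Fintype.card_piFinset_const S m).le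

variable [Fintype F]

lemma mem_linePoints {a x : Fin m → F} {B : Finset (Fin m → F)} :
    x ∈ linePoints a B ↔ ∃ b ∈ B, ∃ t : F, x = a + t • b := by
  simp only [linePoints, Finset.mem_image, Finset.mem_product, Finset.mem_univ, and_true,
    Prod.exists]
  exact ⟨fun ⟨b, t, hb, h⟩ => ⟨b, hb, t, h.symm⟩, fun ⟨b, hb, t, h⟩ => ⟨b, t, hb, h.symm⟩⟩

lemma card_linePoints_le (a : Fin m → F) (B : Finset (Fin m → F)) :
    (linePoints a B).card ≤ B.card * Fintype.card F :=
  Finset.card_image_le.trans (by rw [Finset.card_product, Finset.card_univ])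

/-- The algorithm is correct if the directions are in general position and at most a third of the
parameters in the grid give lines with many errors. -/
lemma run_localCorrector_eq_some (hs : 0 < s) (hδ : δ₀ < delta s d (Fintype.card F) / 8)
    {S : Finset F} (hS : S.card = gridSize s d (Fintype.card F) δ₀)
    {P : MvPolynomial (Fin m) F} (hP : P.totalDegree ≤ d) {r : (Fin m → F) → Alphabet F m s}
    {a z : Fin m → F} {y : Fin m → Fin m → F} (hy : LinearIndependent F y)
    (hbad : (((Fintype.piFinset fun _ : Fin m => S).filter fun α =>
      ¬ (lineErrors P r a (z + ∑ j, α j • y j) : ℝ) < 4 * δ₀ * Fintype.card F).card : ℝ) ≤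
      1 / 3 * (Fintype.piFinset fun _ : Fin m => S).card) :
    (localCorrector s d δ₀ S a z y).run r = some (orderEval s P a) := by
  refine combine_eq_some hs hδ hS hP hy ?_
  -- Extending the answers by 0 does not matter, since every point of these lines is queried.
  have hcongr : ∀ b ∈ directions S z y, lineErrors P (fun x =>
      if h : x ∈ linePoints a (directions S z y) then r x else 0) a b = lineErrors P r a b := by
    intro b hb
    unfold lineErrors
    congr 1
    refine Finset.filter_congr fun t _ => ?_
    simp only [dif_pos (mem_linePoints.2 ⟨b, hb, t, rfl⟩)]
  have hfilter : ((directions S z y).filter fun b => (lineErrors P (fun x =>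
      if h : x ∈ linePoints a (directions S z y) then r x else 0) a b : ℝ) <
        4 * δ₀ * Fintype.card F) =
      (directions S z y).filter fun b => (lineErrors P r a b : ℝ) < 4 * δ₀ * Fintype.card F :=
    Finset.filter_congr fun b hb => by rw [hcongr b hb]
  refine le_of_le_of_eq ?_ (congrArg (fun T : Finset (Fin m → F) => 3 * T.card) hfilter.symm)
  have hgood : ((directions S z y).filter fun b => (lineErrors P r a b : ℝ) <
      4 * δ₀ * Fintype.card F).card = ((Fintype.piFinset fun _ : Fin m => S).filter fun α =>
      (lineErrors P r a (z + ∑ j, α j • y j) : ℝ) < 4 * δ₀ * Fintype.card F).card := by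
    rw [directions, Finset.filter_image, Finset.card_image_of_injective _ (injective_grid z hy)]
  have hsplit := Finset.card_filter_add_card_filter_not (s := Fintype.piFinset fun _ : Fin m => S)
    (fun α => (lineErrors P r a (z + ∑ j, α j • y j) : ℝ) < 4 * δ₀ * Fintype.card F)
  rw [hgood, card_directions S z hy, ← Fintype.card_piFinset_const]
  have hbad' : 3 * ((Fintype.piFinset fun _ : Fin m => S).filter fun α =>
      ¬ (lineErrors P r a (z + ∑ j, α j • y j) : ℝ) < 4 * δ₀ * Fintype.card F).card ≤
      (Fintype.piFinset fun _ : Fin m => S).card := by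
    have : (3 : ℝ) * ((Fintype.piFinset fun _ : Fin m => S).filter fun α =>
      ¬ (lineErrors P r a (z + ∑ j, α j • y j) : ℝ) < 4 * δ₀ * Fintype.card F).card ≤
      (Fintype.piFinset fun _ : Fin m => S).card := by linarith
    exact_mod_cast this
  omega

/-- The success probability of the local correction algorithm. -/
theorem le_uniformProb_run_localCorrector (hs : 0 < s)
    (hδ : δ₀ < delta s d (Fintype.card F) / 8)
    {S : Finset F} (hS : S.card = gridSize s d (Fintype.card F) δ₀)
    {P : MvPolynomial (Fin m) F} (hP : P.totalDegree ≤ d) {r : (Fin m → F) → Alphabet F m s}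
    (hr : relDist (enc s P) r < δ₀) (a : Fin m → F) :
    1 - (27 / ((S.card : ℝ) ^ m + 27) + 4 / (δ₀ * (Fintype.card F : ℝ))) ≤
      uniformProb (fun ω : (Fin m → F) × (Fin m → Fin m → F) =>
        (localCorrector s d δ₀ S a ω.1 ω.2).run r = some (orderEval s P a)) := by
  have hq := card_pos_real (F := F)
  have hδ₀ : 0 < δ₀ := by
    refine lt_of_le_of_lt ?_ hr
    unfold relDist
    positivity
  have hδ8 : δ₀ < 1 / 8 := by linarith [one_sub_pos_of_lt_delta hδ]
  set ε := 1 / (4 * δ₀ * Fintype.card F) with hε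
  have hε0 : 0 < ε := by positivity
  have h16 : 4 / (δ₀ * (Fintype.card F : ℝ)) = 16 * ε := by
    rw [hε]
    field_simp
    norm_num
  have hS0 : 0 < S.card := by
    refine Nat.pos_of_ne_zero fun h0 => ?_
    have := five_mul_le_card_mul_ordC hS
    rw [h0, zero_mul] at this
    omega
  have hN : (0 : ℝ) < (S.card : ℝ) ^ m := by positivity
  rw [h16]
  -- For ε ≥ 1/16 the claimed lower bound is negative.
  rcases le_or_gt (1 / 16) ε with hbig | hsmall
  · refine le_trans ?_ (uniformProb_nonneg _)
    have : 0 < 27 / ((S.card : ℝ) ^ m + 27) := by positivity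
    linarith
  have hqε : 4 * δ₀ * Fintype.card F * ε = 1 := mul_one_div_cancel (by positivity)
  have hq6 : (8 : ℝ) < Fintype.card F := by
    by_contra! hle
    have h1 : δ₀ * (Fintype.card F : ℝ) ≤ 1 / 8 * 8 := by gcongr
    nlinarith
  -- From δ₀ < 1/8 one gets ε > 2/q, and 6/(5q) ≥ 1/(q - 1) as soon as q ≥ 6.
  have hη : 1 / ((Fintype.card F : ℝ) - 1) ≤ 3 / 5 * ε := by
    rw [div_le_iff₀ (by linarith)]
    have h1 : δ₀ * (Fintype.card F : ℝ) * ε ≤ 1 / 8 * (Fintype.card F : ℝ) * ε := by gcongr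
    nlinarith
  set p := uniformProb (fun b => ¬ (lineErrors P r a b : ℝ) < 4 * δ₀ * Fintype.card F) with hp
  have hple : p ≤ 1 / 4 + ε := uniformProb_lineErrors_le hr hδ₀ a
  have hcantelli := uniformProb_card_directions_gt_le hS0
    (fun b => ¬ (lineErrors P r a b : ℝ) < 4 * δ₀ * Fintype.card F) (by linarith)
  have hdep : uniformProb (fun ω : (Fin m → F) × (Fin m → Fin m → F) =>
      ¬ LinearIndependent F ω.2) ≤ 1 / ((Fintype.card F : ℝ) - 1) := by
    refine le_of_eq_of_le (uniformProb_comp_of_surjective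
      (AddMonoidHom.snd (Fin m → F) (Fin m → Fin m → F)) Prod.snd_surjective
      (fun y => ¬ LinearIndependent F y)) (uniformProb_not_linearIndependent_le ?_)
    have : (1 : ℝ) < Fintype.card F := by linarith
    exact_mod_cast this
  have hfail : uniformProb (fun ω : (Fin m → F) × (Fin m → Fin m → F) =>
      ¬ (localCorrector s d δ₀ S a ω.1 ω.2).run r = some (orderEval s P a)) ≤
      27 / ((S.card : ℝ) ^ m + 27) + 16 * ε := by
    refine (uniformProb_mono (fun ω hω => ?_)).trans ((uniformProb_or_le _ _).trans
      ((add_le_add hcantelli hdep).trans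
        (failure_bound hN (uniformProb_nonneg _) hple hε0.le hsmall hη)))
    by_contra! h
    refine hω (run_localCorrector_eq_some hs hδ hS hP h.2 ?_)
    rw [Fintype.card_piFinset_const, Nat.cast_pow]
    simpa only [not_lt] using h.1
  rw [uniformProb_not] at hfail
  linarith

end Correctness

end MultCode

theorem mainTheorem1 {F : Type*} [Field F] [Fintype F] (m s d : ℕ) (hs : 0 < s)
    (δ₀ : ℝ) (hδ₀ : δ₀ < MultCode.delta s d (Fintype.card F) / 8)
    (S : Finset F) (hS : S.card = MultCode.gridSize s d (Fintype.card F) δ₀)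
    (P : MvPolynomial (Fin m) F) (hP : P.totalDegree ≤ d)
    (r : (Fin m → F) → MultCode.Alphabet F m s)
    (hr : MultCode.relDist (MultCode.enc s P) r < δ₀) (a : Fin m → F) :
    -- correctness with high probability over the uniform choice of `(z, y₁, …, y_m)`
    1 - (27 / ((S.card : ℝ) ^ m + 27) + 4 / (δ₀ * (Fintype.card F : ℝ))) ≤
        MultCode.uniformProb (fun ω : (Fin m → F) × (Fin m → Fin m → F) =>
          (MultCode.localCorrector s d δ₀ S a ω.1 ω.2).run r = some (MultCode.orderEval s P a)) ∧
    -- query complexity, for every choice of `(z, y₁, …, y_m)`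
    (∀ (z : Fin m → F) (y : Fin m → Fin m → F),
      (∀ x : Fin m → F, x ∈ (MultCode.localCorrector s d δ₀ S a z y).queries ↔
        ∃ b ∈ MultCode.directions S z y, ∃ t : F, x = a + t • b) ∧
      (MultCode.directions S z y).card ≤ S.card ^ m ∧
      (MultCode.localCorrector s d δ₀ S a z y).queries.card ≤ S.card ^ m * Fintype.card F) ∧
    S.card ≤ ⌈5 / MultCode.gam s d (Fintype.card F) δ₀⌉₊ := by
  refine ⟨MultCode.le_uniformProb_run_localCorrector hs hδ₀ hS hP hr a, fun z y => ⟨fun x =>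
    MultCode.mem_linePoints, MultCode.card_directions_le S z y, ?_⟩, ?_⟩
  · exact (MultCode.card_linePoints_le a _).trans
      (Nat.mul_le_mul_right _ (MultCode.card_directions_le S z y))
  · rw [hS]
    exact MultCode.gridSize_le hδ₀
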